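/- Let $G$ be a finite connected simple graph. Kemeny's constant of $G$ is $\kappa(G)=\sum_{j}m_{ij}\,\pi(j)$, where $m_{ij}$ is the mean first passage time (expected number of steps, with $m_{jj}=0$) from $i$ to $j$ of the simple random walk on $G$ and $\pi(j)=\deg(j)/\sum_k\deg(k)$ is its stationary distribution; the sum does not depend on the vertex $i$. A pair $\{u,v\}$ of distinct nonadjacent vertices is a Braess edge of $G$ if adding the edge $\{u,v\}$ to $G$ strictly increases $\kappa$, and $B(G)$ denotes the number of Braess edges of $G$. Let $\mathcal P_n$ be the path on $n$ vertices, and let $\mathcal S_{a,b}$ be the spider graph obtained from $b$ disjoint paths with $a$ vertices each by joining one end-vertex of each path to a new central vertex (so each leg has length $a$). Theorem 4.7. The series $T_1^\infty=\sum_{l=3}^{\infty}\left(\frac{l}{l^2-l+1}-\frac1l\right)$ converges absolutely. For all integers $a\ge 2$ and $b\ge 2$, $$\frac b2\,B(\mathcal P_{2a+1})\le B(\mathcal S_{a,b})\le\left(\tfrac12\ln(3a+1)+T_1^\infty+\gamma-2\right)ab+\varepsilon(a)\,b,$$ where $\gamma$ is Euler's constant and $\varepsilon$ is a function of $a$ alone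 (not of $b$) with $\varepsilon(a)=o(a)$ as $a\to\infty$. Consequently $B(\mathcal S_{a,b})=\Theta(ab\ln a)$ for sufficiently large $a$, uniformly in $b$: there are constants $c,C>0$ and $A\in\mathbb N$ such that $$c\,ab\ln a\le B(\mathcal S_{a,b})\le C\,ab\ln a\qquad\text{for all integers }a\ge A,\ b\ge 2.$$ -/

import Mathlib

open Filter Asymptotics

noncomputable section

namespace Braess

variable {V : Type*} [Fintype V]

open Classical in
/-- Transition probability from `i` to `j` of the simple random walk on `G`. -/
def transProb (G : SimpleGraph V) (i j : V) : ℝ :=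
  if G.Adj i j then 1 / (G.degree i : ℝ) else 0

open Classical in
/-- The stationary distribution of the simple random walk on `G`: `deg j / ∑ deg`
(see `sum_statDist` and `statDist_stationary`; for connected `G` it is the only one). -/
def statDist (G : SimpleGraph V) (j : V) : ℝ :=
  (G.degree j : ℝ) / ∑ k, (G.degree k : ℝ)

open Classical in
theorem statDist_stationary (G : SimpleGraph V) (j : V) :
    ∑ i, statDist G i * transProb G i j = statDist G j := by
  have h : ∀ i, statDist G i * transProb G i j =
      (if G.Adj j i then (1 : ℝ) else 0) / ∑ k, (G.degree k : ℝ) := by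
    intro i
    unfold statDist transProb
    by_cases hij : G.Adj i j
    · have hd : (G.degree i : ℝ) ≠ 0 := by
        have : 0 < G.degree i := (G.degree_pos_iff_exists_adj i).2 ⟨j, hij⟩
        positivity
      rw [if_pos hij.symm, if_pos hij]
      field_simp
    · have hji : ¬ G.Adj j i := fun h => hij h.symm
      simp [hij, hji]
  rw [Finset.sum_congr rfl fun i _ => h i, ← Finset.sum_div, Finset.sum_boole]
  unfold statDist
  congr 2
  rw [← G.card_neighborFinset_eq_degree j, G.neighborFinset_eq_filter]

open Classical in
theorem sum_statDist (G : SimpleGraph V) (u v : V) (h : G.Adj u v) :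
    ∑ j, statDist G j = 1 := by
  unfold statDist
  rw [← Finset.sum_div]
  apply div_self
  have h1 : 0 < G.degree u := (G.degree_pos_iff_exists_adj u).2 ⟨v, h⟩
  have h2 : (G.degree u : ℝ) ≤ ∑ k, (G.degree k : ℝ) :=
    Finset.single_le_sum (f := fun k => (G.degree k : ℝ)) (fun _ _ => by positivity)
      (Finset.mem_univ u)
  have h3 : (0 : ℝ) < G.degree u := by exact_mod_cast h1
  linarith

open Classical in
/-- Probability that the walk started at `i` visits `j` for the first time at step `n`
(time `0` counts, so the first passage from `j` to `j` takes `0` steps). -/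
def firstPassageProb (G : SimpleGraph V) (j : V) : ℕ → V → ℝ
  | 0, i => if i = j then 1 else 0
  | n + 1, i => if i = j then 0 else ∑ k, transProb G i k * firstPassageProb G j n k

/-- Mean first passage time from `i` to `j`: the expected number of steps to go from `i` to `j`.
As the state space is finite, `firstPassageProb G j n i` decays geometrically in `n`, so the
series converges; in a connected graph `j` is reached with probability `1`. -/
def meanFirstPassage (G : SimpleGraph V) (i j : V) : ℝ :=
  ∑' n : ℕ, (n : ℝ) * firstPassageProb G j n i

/-- Kemeny's constant `∑ j, m i j * π j` of a connected graph. Its value does not depend on the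
starting vertex `i`, so an arbitrary one is used. -/
def kemeny [Nonempty V] (G : SimpleGraph V) : ℝ :=
  ∑ j, meanFirstPassage G (Classical.arbitrary V) j * statDist G j

/-- The unordered pair `e` of distinct nonadjacent vertices is a Braess edge of `G` if inserting
it as an edge strictly increases Kemeny's constant. -/
def IsBraessEdge [Nonempty V] (G : SimpleGraph V) (e : Sym2 V) : Prop :=
  ¬ e.IsDiag ∧ e ∉ G.edgeSet ∧ kemeny G < kemeny (G ⊔ SimpleGraph.fromEdgeSet {e})

/-- `B(G)`: the number of Braess edges of `G`. -/
def numBraess [Nonempty V] (G : SimpleGraph V) : ℕ :=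
  {e : Sym2 V | IsBraessEdge G e}.ncard

/-- The spider graph: `none` is the center, and `some (i, k)` is the vertex at distance `k + 1`
from the center on the `i`-th of the `b` legs of length `a`. -/
def spider (a b : ℕ) : SimpleGraph (Option (Fin b × Fin a)) :=
  SimpleGraph.fromRel fun x y =>
    match x, y with
    | none, some (_, k) => (k : ℕ) = 0
    | some (i, k), some (i', k') => i = i' ∧ (k' : ℕ) = k + 1
    | _, none => False

/-- The term `l / (l² - l + 1) - 1 / l`. -/
def tTerm (l : ℕ) : ℝ :=
  (l : ℝ) / ((l : ℝ) ^ 2 - l + 1) - 1 / (l : ℝ)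

/-- `T₁^∞`: the sum of the terms with `l ≥ 3`. -/
def tInfty : ℝ := ∑' n : ℕ, tTerm (n + 3)

end Braess

end

/-! Kemeny's constant is a degree-weighted sum of effective resistances: with degrees d, it equals
(∑ d_x d_y r(x,y)) / (2 ∑ d_x). Inserting an edge {u,v} lowers r(x,y) by (g x - g y)² / (1 +
r(u,v)), where g is the potential of a unit current between u and v, and raises two degrees by one.
Whether {u,v} is Braess is therefore decided by a few single sums (`isBraessEdge_iff`). The spider
is a tree, so resistance is distance there and these sums are polynomials.

The outcome: with the center counted on every leg, no pair that needs two legs is Braess. A pair on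
one leg, at distance r, whose outer vertex is at distance p from the tip, is Braess iff `excess a b
r p` is positive. This quantity is 8a(b-2)E plus its value at b = 2, where E = (1+r)(a - r(r+2)/3) -
p(r²+r+1). The key inequality `path_excess_nonpos` says that E ≤ 0 makes the value at b = 2
nonpositive. Hence every Braess pair has E > 0, and every Braess pair for b = 2 remains one for
larger b. The spider with two legs is the path on 2a+1 vertices, and the number of Braess edges is b
times the number of admissible (r,p); this gives the lower bound.

For the upper bound put l = r+1. Then E > 0 reads p < l/(l²-l+1) · (a - (l²-1)/3), which forces l² <
3a+1. As l/(l²-l+1) is `tTerm l` plus 1/l, summing over 3 ≤ l ≤ √(3a+1) produces T₁^∞ + γ + ½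
ln(3a+1) - 3/2 as the coefficient of a. The negative part, about l/3 for each l, sums to a/2 and
turns -3/2 into -2. For the order of growth, the pairs with r(r+2) ≤ a and 3(r+1)p ≤ a are already
Braess on the path (`path_excess_pos`), and there are at least of order a ln a of them. -/

namespace Braess

/-! ### Mean first passage times from the first-step equations. -/

section HittingTimes

variable {V : Type*}

open Classical in
/-- The adjacency matrix with real entries. -/
noncomputable def adjWeight (G : SimpleGraph V) (x y : V) : ℝ := if G.Adj x y then 1 else 0

theorem adjWeight_comm (G : SimpleGraph V) (x y : V) : adjWeight G x y = adjWeight G y x := by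
  unfold adjWeight
  by_cases h : G.Adj x y
  · rw [if_pos h, if_pos h.symm]
  · rw [if_neg h, if_neg fun h1 => h h1.symm]

variable [Fintype V]

/-- The degree, as a sum of adjacency weights. -/
noncomputable def wdeg (G : SimpleGraph V) (x : V) : ℝ := ∑ y, adjWeight G x y

open Classical in
theorem degree_eq_wdeg (G : SimpleGraph V) (x : V) : (G.degree x : ℝ) = wdeg G x := by
  unfold wdeg adjWeight
  rw [Finset.sum_boole, ← G.card_neighborFinset_eq_degree x, G.neighborFinset_eq_filter]

theorem transProb_eq (G : SimpleGraph V) (x y : V) :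
    transProb G x y = adjWeight G x y / wdeg G x := by
  unfold transProb
  rw [degree_eq_wdeg]
  unfold adjWeight
  split_ifs <;> simp

theorem statDist_eq (G : SimpleGraph V) (x : V) :
    statDist G x = wdeg G x / ∑ k, wdeg G k := by
  unfold statDist
  simp only [degree_eq_wdeg]

theorem transProb_nonneg (G : SimpleGraph V) (x y : V) : 0 ≤ transProb G x y := by
  unfold transProb; split_ifs <;> positivity

theorem sum_transProb (G : SimpleGraph V) {x : V} (hx : 0 < wdeg G x) :
    ∑ y, transProb G x y = 1 := by
  simp only [transProb_eq]
  rw [← Finset.sum_div]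
  exact div_self hx.ne'

open Classical in
/-- The transition operator of the walk killed at `j`. -/
noncomputable def killed (G : SimpleGraph V) (j : V) : (V → ℝ) →ₗ[ℝ] (V → ℝ) where
  toFun f i := if i = j then 0 else ∑ k, transProb G i k * f k
  map_add' f g := by
    funext i
    simp only [Pi.add_apply]
    split_ifs <;> simp [mul_add, Finset.sum_add_distrib]
  map_smul' c f := by
    funext i
    simp only [Pi.smul_apply, smul_eq_mul, RingHom.id_apply]
    split_ifs
    · simp
    · rw [Finset.mul_sum]
      exact Finset.sum_congr rfl fun k _ => by ring

open Classical in
theorem killed_apply (G : SimpleGraph V) (j : V) (f : V → ℝ) (i : V) :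
    killed G j f i = if i = j then 0 else ∑ k, transProb G i k * f k := rfl

theorem killed_mono (G : SimpleGraph V) (j : V) {f g : V → ℝ} (h : f ≤ g) :
    killed G j f ≤ killed G j g := by
  intro i
  rw [killed_apply, killed_apply]
  split_ifs
  · exact le_rfl
  · exact Finset.sum_le_sum fun k _ => mul_le_mul_of_nonneg_left (h k) (transProb_nonneg G i k)

theorem killed_pow_mono (G : SimpleGraph V) (j : V) {f g : V → ℝ} (h : f ≤ g) (n : ℕ) :
    (killed G j ^ n) f ≤ (killed G j ^ n) g := by
  induction n with
  | zero => simpa using h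
  | succ n ih =>
    rw [pow_succ', Module.End.mul_apply, Module.End.mul_apply]
    exact killed_mono G j ih

open Classical in
theorem firstPassageProb_eq (G : SimpleGraph V) (j : V) (n : ℕ) :
    firstPassageProb G j n = (killed G j ^ n) (fun i => if i = j then 1 else 0) := by
  induction n with
  | zero => funext i; simp [firstPassageProb]
  | succ n ih =>
    funext i
    rw [pow_succ', Module.End.mul_apply, ← ih, killed_apply]
    rfl

/-- A solution of the first-step equations is nonnegative. -/
theorem firstStep_nonneg (G : SimpleGraph V) (hG : ∀ x, 0 < wdeg G x) (j : V) (f : V → ℝ)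
    (hj : f j = 0) (hf : ∀ i, i ≠ j → f i = 1 + ∑ k, transProb G i k * f k) (i : V) :
    0 ≤ f i := by
  have : Nonempty V := ⟨j⟩
  obtain ⟨x, hx⟩ := Finite.exists_min f
  by_cases hxj : x = j
  · rw [← hj, ← hxj]; exact hx i
  · exfalso
    have h1 := hf x hxj
    have h2 : f x ≤ ∑ k, transProb G x k * f k := by
      calc f x = ∑ k, transProb G x k * f x := by
            rw [← Finset.sum_mul, sum_transProb G (hG x), one_mul]
        _ ≤ _ := Finset.sum_le_sum fun k _ =>
            mul_le_mul_of_nonneg_left (hx k) (transProb_nonneg G x k)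
    linarith

/-- The mean first passage times are the solution of the first-step equations. -/
theorem meanFirstPassage_eq (G : SimpleGraph V) (hG : ∀ x, 0 < wdeg G x) (j : V) (f : V → ℝ)
    (hj : f j = 0) (hf : ∀ i, i ≠ j → f i = 1 + ∑ k, transProb G i k * f k) (i : V) :
    meanFirstPassage G i j = f i := by
  classical
  set K := killed G j with hK
  set δ : V → ℝ := fun i => if i = j then 1 else 0 with hδ
  set e : V → ℝ := fun i => if i = j then 0 else 1 with he
  have hf0 : 0 ≤ f := fun i => firstStep_nonneg G hG j f hj hf i
  have hKf : f = e + K f := by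
    funext x
    rw [Pi.add_apply, hK, killed_apply]
    by_cases hx : x = j
    · simp [he, hx, hj]
    · simp only [he, if_neg hx]
      exact hf x hx
  have hKe : K δ = e - K e := by
    have h1 : K (δ + e) = e := by
      funext x
      rw [hK, killed_apply]
      by_cases hx : x = j
      · simp [he, hx]
      · have h2 : ∀ k, (δ + e) k = 1 := by
          intro k
          simp only [hδ, he, Pi.add_apply]
          split_ifs <;> norm_num
        rw [if_neg hx, Finset.sum_congr rfl fun k _ => by rw [h2 k, mul_one]]
        simp only [he, if_neg hx]
        exact sum_transProb G (hG x)
    rw [map_add] at h1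
    exact eq_sub_of_add_eq h1
  have hstep : ∀ n, (K ^ (n + 1)) f = (K ^ n) f - (K ^ n) e := by
    intro n
    have h1 : (K ^ n) f = (K ^ n) e + (K ^ n) (K f) := by rw [← map_add, ← hKf]
    rw [pow_succ, Module.End.mul_apply, h1]
    abel
  have hδstep : ∀ n, (K ^ (n + 1)) δ = (K ^ n) e - (K ^ (n + 1)) e := by
    intro n
    rw [pow_succ, Module.End.mul_apply, hKe, map_sub, Module.End.mul_apply]
  have he0 : (0 : V → ℝ) ≤ e := by
    intro x
    simp only [he]
    split_ifs <;> simp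
  have hδ0 : (0 : V → ℝ) ≤ δ := by
    intro x
    simp only [hδ]
    split_ifs <;> simp
  have hpow0 : ∀ g : V → ℝ, 0 ≤ g → ∀ n, 0 ≤ (K ^ n) g := by
    intro g hg n
    have := killed_pow_mono G j hg n
    rwa [map_zero] at this
  have hef : e ≤ f := by
    intro x
    rw [hKf]
    have h1 := hpow0 f hf0 1 x
    rw [pow_one] at h1
    simpa using h1
  obtain ⟨M, hM1, hM⟩ : ∃ M : ℝ, 1 ≤ M ∧ f ≤ M • e := by
    refine ⟨1 + ∑ x, f x, ?_, ?_⟩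
    · have := Finset.sum_nonneg fun x (_ : x ∈ Finset.univ) => hf0 x
      linarith
    · intro x
      by_cases hx : x = j
      · simp [he, hx, hj]
      · have := Finset.single_le_sum (fun y _ => hf0 y) (Finset.mem_univ x)
        simp only [Pi.smul_apply, he, if_neg hx, smul_eq_mul, mul_one]
        linarith
  have hM0 : 0 < M := by linarith
  set ρ : ℝ := 1 - 1 / M with hρ
  have hρ0 : 0 ≤ ρ := by
    have : 1 / M ≤ 1 := by rw [div_le_one hM0]; exact hM1
    linarith
  have hρ1 : ρ < 1 := by
    have : 0 < 1 / M := by positivity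
    linarith
  -- By f ≤ M • e, the loss Kⁿ e in `hstep` is at least the fraction 1/M of Kⁿ f, so Kⁿ f shrinks
  -- geometrically.
  have hdecay : ∀ n x, (K ^ n) f x ≤ ρ ^ n * f x := by
    intro n x
    induction n with
    | zero => simp
    | succ n ih =>
      have h1 := killed_pow_mono G j hM n x
      rw [map_smul, Pi.smul_apply, smul_eq_mul, ← hK] at h1
      have h2 : (K ^ n) f x / M ≤ (K ^ n) e x := by
        rw [div_le_iff₀ hM0]; linarith
      rw [hstep, Pi.sub_apply, pow_succ']
      calc (K ^ n) f x - (K ^ n) e x ≤ (K ^ n) f x - (K ^ n) f x / M := by linarith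
        _ = ρ * (K ^ n) f x := by rw [hρ]; ring
        _ ≤ ρ * (ρ ^ n * f x) := mul_le_mul_of_nonneg_left ih hρ0
        _ = _ := by ring
  -- Summation by parts: Kⁿ e is the probability that j has not been visited by time n, and the sum
  -- of these tails telescopes by `hstep`.
  have hsum : ∀ N : ℕ, ∑ n ∈ Finset.range (N + 1), (n : ℝ) * firstPassageProb G j n i =
      f i - (K ^ N) f i - N * (K ^ N) e i := by
    intro N
    induction N with
    | zero => simp
    | succ N ih =>
      rw [Finset.sum_range_succ, ih, firstPassageProb_eq, ← hK, ← hδ, hδstep, hstep]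
      simp only [Pi.sub_apply]
      push_cast
      ring
  have hlim1 : Tendsto (fun N => (K ^ N) f i) atTop (nhds 0) := by
    have h2 : Tendsto (fun N : ℕ => ρ ^ N * f i) atTop (nhds 0) := by
      simpa using (tendsto_pow_atTop_nhds_zero_of_lt_one hρ0 hρ1).mul_const (f i)
    exact squeeze_zero (fun N => hpow0 f hf0 N i) (fun N => hdecay N i) h2
  have hlim2 : Tendsto (fun N : ℕ => (N : ℝ) * (K ^ N) e i) atTop (nhds 0) := by
    have h2 : Tendsto (fun N : ℕ => (N * ρ ^ N) * f i) atTop (nhds 0) := by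
      simpa using (tendsto_self_mul_const_pow_of_lt_one hρ0 hρ1).mul_const (f i)
    refine squeeze_zero (fun N => mul_nonneg (Nat.cast_nonneg N) (hpow0 e he0 N i)) (fun N => ?_) h2
    rw [mul_assoc]
    exact mul_le_mul_of_nonneg_left ((killed_pow_mono G j hef N i).trans (hdecay N i))
      (Nat.cast_nonneg N)
  unfold meanFirstPassage
  refine HasSum.tsum_eq ((hasSum_iff_tendsto_nat_of_nonneg (fun n => ?_) _).2 ?_)
  · rw [firstPassageProb_eq]
    exact mul_nonneg (Nat.cast_nonneg n) (hpow0 δ hδ0 n i)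
  · rw [← tendsto_add_atTop_iff_nat 1]
    simp only [hsum]
    simpa using (tendsto_const_nhds.sub hlim1).sub hlim2

end HittingTimes

/-! ### Kemeny's constant through resistances, and the effect of a new edge. -/

section Resistance

variable {V : Type*} [Fintype V]

open Classical in
/-- The characteristic properties of the effective resistance of a graph. -/
structure IsResistance (G : SimpleGraph V) (r : V → V → ℝ) : Prop where
  self : ∀ x, r x x = 0
  symm : ∀ x y, r x y = r y x
  lap : ∃ τ : V → ℝ, ∀ x z,
    ∑ y, adjWeight G x y * (r x z - r y z) = τ x - 2 * (if x = z then 1 else 0)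

/-- The degree-weighted sum of all resistances. -/
noncomputable def gutman (G : SimpleGraph V) (r : V → V → ℝ) : ℝ :=
  ∑ x, wdeg G x * ∑ y, wdeg G y * r x y

variable {G : SimpleGraph V} {r : V → V → ℝ}

/-- Multiplied by the degree, the first-step equation at i asks that the Laplacian of the right-hand
side be deg i. In r(i,j) - r(i,k) the unknown τ cancels, and only the point mass at k = i survives.
-/
theorem IsResistance.meanFirstPassage_eq (h : IsResistance G r) (hG : ∀ x, 0 < wdeg G x)
    (i j : V) :
    meanFirstPassage G i j = 1 / 2 * ∑ k, wdeg G k * (r i j + r j k - r i k) := by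
  classical
  refine Braess.meanFirstPassage_eq G hG j
    (fun i => 1 / 2 * ∑ k, wdeg G k * (r i j + r j k - r i k)) ?_ ?_ i
  · simp [h.self]
  · intro i hij
    obtain ⟨τ, hτ⟩ := h.lap
    set f : V → ℝ := fun i => 1 / 2 * ∑ k, wdeg G k * (r i j + r j k - r i k) with hf
    have hlap : ∑ y, adjWeight G i y * (f i - f y) = wdeg G i := by
      have h1 : ∀ y, adjWeight G i y * (f i - f y) = 1 / 2 * ∑ k, wdeg G k *
          (adjWeight G i y * (r i j - r y j) - adjWeight G i y * (r i k - r y k)) := by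
        intro y
        simp only [hf]
        rw [← mul_sub, ← Finset.sum_sub_distrib, mul_left_comm, Finset.mul_sum]
        congr 1
        exact Finset.sum_congr rfl fun k _ => by ring
      rw [Finset.sum_congr rfl fun y _ => h1 y, ← Finset.mul_sum, Finset.sum_comm]
      have h2 : ∀ k, ∑ y, wdeg G k *
          (adjWeight G i y * (r i j - r y j) - adjWeight G i y * (r i k - r y k)) =
          if i = k then 2 * wdeg G k else 0 := by
        intro k
        rw [← Finset.mul_sum, Finset.sum_sub_distrib, hτ, hτ, if_neg hij]
        split_ifs <;> ring
      rw [Finset.sum_congr rfl fun k _ => h2 k, Finset.sum_ite_eq]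
      simp
    change f i = 1 + ∑ k, transProb G i k * f k
    have hd := (hG i).ne'
    simp only [transProb_eq, div_mul_eq_mul_div]
    rw [← Finset.sum_div]
    simp only [mul_sub, Finset.sum_sub_distrib] at hlap
    rw [← Finset.sum_mul] at hlap
    change wdeg G i * f i - _ = _ at hlap
    rw [eq_comm, ← eq_sub_iff_add_eq', div_eq_iff hd]
    linarith

/-- Kemeny's constant in terms of effective resistances, for every starting vertex. -/
theorem IsResistance.sum_meanFirstPassage (h : IsResistance G r) (hG : ∀ x, 0 < wdeg G x)
    (i : V) :
    ∑ j, meanFirstPassage G i j * statDist G j = gutman G r / (2 * ∑ k, wdeg G k) := by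
  have hD : 0 < ∑ k, wdeg G k := Finset.sum_pos (fun k _ => hG k) ⟨i, Finset.mem_univ i⟩
  set D := ∑ k, wdeg G k with hDdef
  have h1 : ∀ j, meanFirstPassage G i j * statDist G j =
      (wdeg G j * (r i j * D) + wdeg G j * ∑ k, wdeg G k * r j k -
        wdeg G j * ∑ k, wdeg G k * r i k) / (2 * D) := by
    intro j
    rw [h.meanFirstPassage_eq hG, statDist_eq, ← hDdef]
    simp only [mul_sub, mul_add, Finset.sum_sub_distrib, Finset.sum_add_distrib]
    rw [← Finset.sum_mul, ← hDdef]
    field_simp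
  rw [Finset.sum_congr rfl fun j _ => h1 j, ← Finset.sum_div]
  congr 1
  simp only [Finset.sum_sub_distrib, Finset.sum_add_distrib]
  rw [← Finset.sum_mul, ← hDdef]
  simp only [← mul_assoc]
  rw [← Finset.sum_mul]
  unfold gutman
  ring

theorem IsResistance.kemeny_eq [Nonempty V] (h : IsResistance G r) (hG : ∀ x, 0 < wdeg G x) :
    kemeny G = gutman G r / (2 * ∑ k, wdeg G k) :=
  h.sum_meanFirstPassage hG _

open Classical in
theorem adjWeight_sup_edge {W : Type*} {G : SimpleGraph W} {u v : W} (huv : u ≠ v) (hadj : ¬ G.Adj u v) (x y : W) :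
    adjWeight (G ⊔ SimpleGraph.fromEdgeSet {s(u, v)}) x y =
      adjWeight G x y + (if x = u then (if y = v then 1 else 0) else 0) +
        (if x = v then (if y = u then 1 else 0) else 0) := by
  have hadj' : ¬ G.Adj v u := fun h => hadj h.symm
  unfold adjWeight
  simp only [SimpleGraph.sup_adj, SimpleGraph.fromEdgeSet_adj, Set.mem_singleton_iff,
    Sym2.eq_iff]
  by_cases h1 : x = u
  · subst h1
    by_cases h2 : y = v
    · subst h2; simp [hadj, huv]
    · simp [h2, huv]
  · by_cases h2 : x = v
    · subst h2
      by_cases h3 : y = u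
      · subst h3; simp [hadj', h1]
      · simp [h1, h3]
    · simp [h1, h2]

open Classical in
theorem sum_adjWeight_sup_edge {u v : V} (huv : u ≠ v) (hadj : ¬ G.Adj u v) (x : V)
    (F : V → ℝ) :
    ∑ y, adjWeight (G ⊔ SimpleGraph.fromEdgeSet {s(u, v)}) x y * F y =
      ∑ y, adjWeight G x y * F y + (if x = u then F v else 0) + (if x = v then F u else 0) := by
  simp only [adjWeight_sup_edge huv hadj, add_mul, Finset.sum_add_distrib]
  congr 1
  · congr 1
    split_ifs <;> simp
  · split_ifs <;> simp

open Classical in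
theorem wdeg_sup_edge {u v : V} (huv : u ≠ v) (hadj : ¬ G.Adj u v) (x : V) :
    wdeg (G ⊔ SimpleGraph.fromEdgeSet {s(u, v)}) x =
      wdeg G x + (if x = u then 1 else 0) + (if x = v then 1 else 0) := by
  have := sum_adjWeight_sup_edge huv hadj x (fun _ => 1)
  simpa [wdeg] using this

theorem sum_wdeg_mul_sup_edge {u v : V} (huv : u ≠ v) (hadj : ¬ G.Adj u v) (F : V → ℝ) :
    ∑ x, wdeg (G ⊔ SimpleGraph.fromEdgeSet {s(u, v)}) x * F x =
      ∑ x, wdeg G x * F x + F u + F v := by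
  classical
  simp only [wdeg_sup_edge huv hadj, add_mul, Finset.sum_add_distrib]
  simp

/-- The voltage of a unit current between `u` and `v`. -/
noncomputable def potential (r : V → V → ℝ) (u v x : V) : ℝ := (r x u - r x v) / 2

/-- Inserting an edge is a rank-one update of the effective resistances. -/
theorem IsResistance.sup_edge (h : IsResistance G r) {u v : V} (huv : u ≠ v)
    (hadj : ¬ G.Adj u v) (hr : 0 ≤ r u v) :
    IsResistance (G ⊔ SimpleGraph.fromEdgeSet {s(u, v)})
      (fun x y => r x y - (potential r u v x - potential r u v y) ^ 2 / (1 + r u v)) := by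
  classical
  refine ⟨fun x => by simp [h.self], fun x y => ?_, ?_⟩
  · rw [h.symm x y]; ring
  obtain ⟨τ, hτ⟩ := h.lap
  set g := potential r u v with hg
  set R := r u v with hR
  have hR1 : 1 + R ≠ 0 := by positivity
  have hgu : g u = -R / 2 := by simp [hg, potential, h.self, hR]
  have hgv : g v = R / 2 := by simp [hg, potential, h.self, hR, h.symm v u]
  have hgl : ∀ x, ∑ y, adjWeight G x y * (g x - g y) =
      (if x = v then 1 else 0) - (if x = u then 1 else 0) := by
    intro x
    have h1 : ∀ y, adjWeight G x y * (g x - g y) =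
        1 / 2 * (adjWeight G x y * (r x u - r y u) - adjWeight G x y * (r x v - r y v)) := by
      intro y
      simp only [hg, potential]
      ring
    rw [Finset.sum_congr rfl fun y _ => h1 y, ← Finset.mul_sum, Finset.sum_sub_distrib, hτ, hτ]
    ring
  -- Expanding (g x - g z)², the part g x² does not involve z and goes into the new τ. The cross
  -- term has Laplacian supported at u and v, where the new edge cancels it.
  refine ⟨fun x => τ x - (∑ y, adjWeight G x y * (g x ^ 2 - g y ^ 2)) / (1 + R), fun x z => ?_⟩
  rw [sum_adjWeight_sup_edge huv hadj]
  have h2 : ∀ y, adjWeight G x y * (r x z - (g x - g z) ^ 2 / (1 + R) -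
      (r y z - (g y - g z) ^ 2 / (1 + R))) = adjWeight G x y * (r x z - r y z) -
      (adjWeight G x y * (g x ^ 2 - g y ^ 2)) / (1 + R) +
      2 * g z / (1 + R) * (adjWeight G x y * (g x - g y)) := by
    intro y
    field_simp
    ring
  rw [Finset.sum_congr rfl fun y _ => h2 y, Finset.sum_add_distrib, Finset.sum_sub_distrib, hτ,
    ← Finset.sum_div, ← Finset.mul_sum, hgl]
  have h3 : r u z - r v z = 2 * g z := by
    simp only [hg, potential, h.symm z]
    ring
  have h4 : r u z - (g u - g z) ^ 2 / (1 + R) - (r v z - (g v - g z) ^ 2 / (1 + R)) =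
      2 * g z / (1 + R) := by
    have h5 : r u z = r v z + 2 * g z := by linarith
    rw [h5, hgu, hgv]
    field_simp
    ring
  have h6 : r v z - (g v - g z) ^ 2 / (1 + R) - (r u z - (g u - g z) ^ 2 / (1 + R)) =
      -(2 * g z / (1 + R)) := by rw [← h4]; ring
  by_cases hxu : x = u
  · subst hxu
    rw [if_neg huv, if_pos rfl, if_pos rfl, if_neg huv, h4]
    ring
  · by_cases hxv : x = v
    · subst hxv
      rw [if_pos rfl, if_neg hxu, if_neg hxu, if_pos rfl, h6]
      ring
    · rw [if_neg hxv, if_neg hxu, if_neg hxu, if_neg hxv]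
      ring

/-- Expanding (g x - g y)² splits the double sum into the degree-weighted first and second moments
of g; the terms outside the fraction come from the two raised degrees. -/
theorem gutman_sup_edge (h : IsResistance G r) {u v : V} (huv : u ≠ v) (hadj : ¬ G.Adj u v) :
    gutman (G ⊔ SimpleGraph.fromEdgeSet {s(u, v)})
      (fun x y => r x y - (potential r u v x - potential r u v y) ^ 2 / (1 + r u v)) =
    gutman G r + 2 * (∑ x, wdeg G x * r x u + ∑ x, wdeg G x * r x v) + 2 * r u v -
      (2 * (∑ x, wdeg G x + 2) *
          (∑ x, wdeg G x * potential r u v x ^ 2 + r u v ^ 2 / 2) -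
        2 * (∑ x, wdeg G x * potential r u v x) ^ 2) / (1 + r u v) := by
  set g := potential r u v with hg
  set R := r u v with hR
  have hgu : g u = -R / 2 := by simp [hg, potential, h.self, hR]
  have hgv : g v = R / 2 := by simp [hg, potential, h.self, hR, h.symm v u]
  set D := ∑ x, wdeg G x with hD
  set A := ∑ x, wdeg G x * g x with hA
  set B := ∑ x, wdeg G x * g x ^ 2 with hB
  have key : ∀ x, ∑ y, wdeg G y * (r x y - (g x - g y) ^ 2 / (1 + R)) =
      ∑ y, wdeg G y * r x y - (D * g x ^ 2 - 2 * g x * A + B) / (1 + R) := by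
    intro x
    have h1 : ∀ y, wdeg G y * (r x y - (g x - g y) ^ 2 / (1 + R)) = wdeg G y * r x y -
        (wdeg G y * g x ^ 2 - 2 * g x * (wdeg G y * g y) + wdeg G y * g y ^ 2) / (1 + R) := by
      intro y; ring
    rw [Finset.sum_congr rfl fun y _ => h1 y, Finset.sum_sub_distrib, ← Finset.sum_div,
      Finset.sum_add_distrib, Finset.sum_sub_distrib, ← Finset.sum_mul, ← Finset.mul_sum]
  unfold gutman
  simp only [sum_wdeg_mul_sup_edge huv hadj, key]
  have h2 : ∀ x, wdeg G x * (∑ y, wdeg G y * r x y -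
        (D * g x ^ 2 - 2 * g x * A + B) / (1 + R) +
        (r x u - (g x - g u) ^ 2 / (1 + R)) + (r x v - (g x - g v) ^ 2 / (1 + R))) =
      wdeg G x * ∑ y, wdeg G y * r x y + wdeg G x * r x u + wdeg G x * r x v -
      ((D + 2) * (wdeg G x * g x ^ 2) - 2 * A * (wdeg G x * g x) +
        wdeg G x * (B + R ^ 2 / 2)) / (1 + R) := by
    intro x
    rw [hgu, hgv]
    ring
  rw [Finset.sum_congr rfl fun x _ => h2 x, Finset.sum_sub_distrib, ← Finset.sum_div]
  simp only [Finset.sum_add_distrib, Finset.sum_sub_distrib]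
  rw [← Finset.mul_sum, ← Finset.mul_sum, ← Finset.sum_mul, ← hA, ← hB, ← hD, hgu, hgv,
    h.self u, h.self v, h.symm v u, ← hR]
  simp only [h.symm u, h.symm v]
  ring_nf

/-- The resistances decide whether a nonadjacent pair is a Braess edge. -/
theorem isBraessEdge_iff [Nonempty V] (h : IsResistance G r) (hG : ∀ x, 0 < wdeg G x) {u v : V}
    (huv : u ≠ v) (hadj : ¬ G.Adj u v) (hr : 0 ≤ r u v) :
    IsBraessEdge G s(u, v) ↔
      0 < (∑ x, wdeg G x) * (2 * (∑ x, wdeg G x * r x u + ∑ x, wdeg G x * r x v) + 2 * r u v -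
      (2 * (∑ x, wdeg G x + 2) *
          (∑ x, wdeg G x * potential r u v x ^ 2 + r u v ^ 2 / 2) -
        2 * (∑ x, wdeg G x * potential r u v x) ^ 2) / (1 + r u v)) - 2 * gutman G r := by
  classical
  have hG' : ∀ x, 0 < wdeg (G ⊔ SimpleGraph.fromEdgeSet {s(u, v)}) x := by
    intro x
    rw [wdeg_sup_edge huv hadj]
    have := hG x
    split_ifs <;> linarith
  have hD : 0 < ∑ x, wdeg G x := Finset.sum_pos (fun k _ => hG k) Finset.univ_nonempty
  have hD' : ∑ x, wdeg (G ⊔ SimpleGraph.fromEdgeSet {s(u, v)}) x = ∑ x, wdeg G x + 2 := by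
    have := sum_wdeg_mul_sup_edge huv hadj (fun _ => (1 : ℝ))
    simp only [mul_one] at this
    rw [this]; ring
  unfold IsBraessEdge
  rw [Sym2.mk_isDiag_iff, SimpleGraph.mem_edgeSet, h.kemeny_eq hG,
    (h.sup_edge huv hadj hr).kemeny_eq hG', gutman_sup_edge h huv hadj, hD',
    div_lt_div_iff₀ (by positivity) (by positivity)]
  simp only [huv, hadj, not_false_eq_true, true_and]
  constructor
  · intro h1; linarith
  · intro h1; linarith

end Resistance

/-! ### Invariance under graph isomorphism. -/

section Isomorphism

variable {V W : Type*} {G : SimpleGraph V} {H : SimpleGraph W}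

theorem adjWeight_iso (e : G ≃g H) (x y : V) : adjWeight H (e x) (e y) = adjWeight G x y := by
  unfold adjWeight
  by_cases h : G.Adj x y
  · rw [if_pos h, if_pos (e.map_adj_iff.2 h)]
  · rw [if_neg h, if_neg fun h1 => h (e.map_adj_iff.1 h1)]

variable [Fintype V] [Fintype W]

theorem wdeg_iso (e : G ≃g H) (x : V) : wdeg H (e x) = wdeg G x := by
  unfold wdeg
  rw [← Equiv.sum_comp e.toEquiv]
  exact Finset.sum_congr rfl fun y _ => adjWeight_iso e x y

theorem IsResistance.iso {r : W → W → ℝ} (h : IsResistance H r) (e : G ≃g H) :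
    IsResistance G (fun x y => r (e x) (e y)) := by
  classical
  obtain ⟨τ, hτ⟩ := h.lap
  refine ⟨fun x => h.self _, fun x y => h.symm _ _, fun x => τ (e x), fun x z => ?_⟩
  have := hτ (e x) (e z)
  rw [← Equiv.sum_comp e.toEquiv] at this
  simp only [e.injective.eq_iff] at this
  rw [← this]
  exact Finset.sum_congr rfl fun y _ => by rw [← adjWeight_iso e x y]; rfl

theorem gutman_iso (e : G ≃g H) (r : W → W → ℝ) :
    gutman G (fun x y => r (e x) (e y)) = gutman H r := by
  unfold gutman
  rw [← Equiv.sum_comp e.toEquiv]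
  refine Finset.sum_congr rfl fun x _ => ?_
  rw [← Equiv.sum_comp e.toEquiv]
  simp only [← wdeg_iso e]
  rfl

/-- An isomorphism need not match the arbitrary starting vertices in `kemeny`; the resistance
formula has no starting vertex. -/
theorem kemeny_iso [Nonempty V] [Nonempty W] {r : W → W → ℝ} (h : IsResistance H r)
    (hH : ∀ x, 0 < wdeg H x) (e : G ≃g H) : kemeny G = kemeny H := by
  have hG : ∀ x, 0 < wdeg G x := fun x => by rw [← wdeg_iso e]; exact hH _
  rw [h.kemeny_eq hH, (h.iso e).kemeny_eq hG, gutman_iso, ← Equiv.sum_comp e.toEquiv]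
  simp only [← wdeg_iso e]
  rfl

/-- An isomorphism extends to the graphs with an additional edge. -/
def isoSupEdge (e : G ≃g H) (u v : V) :
    (G ⊔ SimpleGraph.fromEdgeSet {s(u, v)}) ≃g
      (H ⊔ SimpleGraph.fromEdgeSet {s(e u, e v)}) where
  toEquiv := e.toEquiv
  map_rel_iff' := by
    intro x y
    simp only [SimpleGraph.sup_adj, SimpleGraph.fromEdgeSet_adj, Set.mem_singleton_iff,
      Sym2.eq_iff]
    change H.Adj (e x) (e y) ∨ ((e x = e u ∧ e y = e v ∨ e x = e v ∧ e y = e u) ∧ e x ≠ e y) ↔ _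
    rw [e.map_adj_iff]
    simp only [e.injective.eq_iff, ne_eq]

theorem isBraessEdge_iso [Nonempty V] [Nonempty W] {r : W → W → ℝ} (h : IsResistance H r)
    (hr : ∀ x y, 0 ≤ r x y) (hH : ∀ x, 0 < wdeg H x) (e : G ≃g H) (z : Sym2 V) :
    IsBraessEdge H (z.map e) ↔ IsBraessEdge G z := by
  classical
  induction z with | _ u v
  rw [Sym2.map_mk]
  have hG : ∀ x, 0 < wdeg G x := fun x => by rw [← wdeg_iso e]; exact hH _
  unfold IsBraessEdge
  simp only [Sym2.mk_isDiag_iff, SimpleGraph.mem_edgeSet, e.map_adj_iff, e.injective.eq_iff]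
  refine and_congr_right fun huv => and_congr_right fun hadj => ?_
  have huv' : e u ≠ e v := fun h => huv (e.injective h)
  have hadj' : ¬ H.Adj (e u) (e v) := fun h => hadj (e.map_adj_iff.1 h)
  have hH' : ∀ x, 0 < wdeg (H ⊔ SimpleGraph.fromEdgeSet {s(e u, e v)}) x := by
    intro x
    rw [wdeg_sup_edge huv' hadj']
    have := hH x
    split_ifs <;> linarith
  rw [kemeny_iso h hH e, kemeny_iso (h.sup_edge huv' hadj' (hr _ _)) hH' (isoSupEdge e u v)]

theorem numBraess_iso [Nonempty V] [Nonempty W] {r : W → W → ℝ} (h : IsResistance H r)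
    (hr : ∀ x y, 0 ≤ r x y) (hH : ∀ x, 0 < wdeg H x) (e : G ≃g H) :
    numBraess G = numBraess H := by
  unfold numBraess
  rw [← Set.ncard_image_of_injective _ (Sym2.map.injective e.injective)]
  congr 1
  ext z
  constructor
  · rintro ⟨y, hy, rfl⟩
    exact (isBraessEdge_iso h hr hH e y).2 hy
  · intro hz
    have hz' : (z.map e.symm).map e = z := by
      rw [Sym2.map_map]
      simp
    refine ⟨z.map e.symm, (isBraessEdge_iso h hr hH e _).1 ?_, hz'⟩
    rw [hz']
    exact hz

end Isomorphism

/-! ### Degree-weighted sums along a path. -/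

section EdgeSum

/-- The sum of a vertex function over both ends of every edge of a path with `n` edges. -/
def edgeSum (n : ℕ) (f : ℕ → ℝ) : ℝ := ∑ k ∈ Finset.range n, (f k + f (k + 1))

theorem edgeSum_add (m n : ℕ) (f : ℕ → ℝ) :
    edgeSum (m + n) f = edgeSum m f + edgeSum n (fun k => f (m + k)) := by
  unfold edgeSum
  rw [Finset.sum_range_add]
  rfl

theorem edgeSum_congr {n : ℕ} {f g : ℕ → ℝ} (h : ∀ k ≤ n, f k = g k) :
    edgeSum n f = edgeSum n g := by
  unfold edgeSum
  refine Finset.sum_congr rfl fun k hk => ?_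
  have := Finset.mem_range.1 hk
  rw [h k this.le, h (k + 1) this]

/-- Distances, potentials and their squares are piecewise quadratic along a leg, so together with
`edgeSum_add` this evaluates all the sums needed. -/
theorem edgeSum_quadratic {n : ℕ} {f : ℕ → ℝ} (α β γ : ℝ)
    (h : ∀ k ≤ n, f k = α + β * k + γ * (k : ℝ) ^ 2) :
    edgeSum n f = 2 * α * n + β * n ^ 2 + γ * (n * (2 * n ^ 2 + 1) / 3) := by
  rw [edgeSum_congr h]
  clear h
  unfold edgeSum
  induction n with
  | zero => simp
  | succ n ih =>
    rw [Finset.sum_range_succ, ih]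
    push_cast
    ring

theorem edgeSum_eq {n : ℕ} (hn : 0 < n) (f : ℕ → ℝ) :
    edgeSum n f = f 0 +
      ∑ k ∈ Finset.range n, (1 + if k + 1 < n then (1 : ℝ) else 0) * f (k + 1) := by
  obtain ⟨n, rfl⟩ := Nat.exists_eq_succ_of_ne_zero hn.ne'
  have h1 : ∑ k ∈ Finset.range (n + 1), (if k + 1 < n + 1 then (1 : ℝ) else 0) * f (k + 1) =
      ∑ k ∈ Finset.range n, f (k + 1) := by
    rw [Finset.sum_range_succ, if_neg (lt_irrefl _), zero_mul, add_zero]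
    refine Finset.sum_congr rfl fun k hk => ?_
    rw [if_pos (Nat.succ_lt_succ (Finset.mem_range.1 hk)), one_mul]
  unfold edgeSum
  simp only [add_mul, Finset.sum_add_distrib, one_mul, Nat.succ_eq_add_one]
  rw [h1, Finset.sum_range_succ' f]
  ring

end EdgeSum

/-- Used with ι the set of legs: all legs containing no marked vertex contribute equally. -/
theorem sum_eq_of_forall_ne {ι : Type*} [Fintype ι] (i : ι) (h : ι → ℝ) (c : ℝ)
    (hc : ∀ j, j ≠ i → h j = c) : ∑ j, h j = h i + (Fintype.card ι - 1) * c := by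
  classical
  have h1 : ∀ j, h j = c + if j = i then h i - c else 0 := by
    intro j
    split_ifs with hj
    · rw [hj]; ring
    · rw [hc j hj]; ring
  rw [Finset.sum_congr rfl fun j _ => h1 j, Finset.sum_add_distrib, Finset.sum_ite_eq']
  simp
  ring

theorem sum_eq_of_forall_ne_ne {ι : Type*} [Fintype ι] {i j : ι} (hij : i ≠ j) (h : ι → ℝ)
    (c : ℝ) (hc : ∀ k, k ≠ i → k ≠ j → h k = c) :
    ∑ k, h k = h i + h j + (Fintype.card ι - 2) * c := by
  classical
  have h1 : ∀ k, h k = c + (if k = i then h i - c else 0) + if k = j then h j - c else 0 := by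
    intro k
    by_cases hk : k = i
    · rw [if_pos hk, if_neg (by rw [hk]; exact hij), hk]; ring
    · by_cases hk' : k = j
      · rw [if_neg hk, if_pos hk', hk']; ring
      · rw [if_neg hk, if_neg hk', hc k hk hk']; ring
  rw [Finset.sum_congr rfl fun j _ => h1 j, Finset.sum_add_distrib, Finset.sum_add_distrib,
    Finset.sum_ite_eq', Finset.sum_ite_eq']
  simp
  ring

/-! ### The spider: coordinates, degrees and resistances. -/

section Spider

variable {a b : ℕ}

/-- The vertex of the spider at distance `k` from the center on leg `i`. -/
def vtx (i : Fin b) : ℕ → Option (Fin b × Fin a)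
  | 0 => none
  -- Beyond the tip the value is the center, a dummy; this is why later statements ask for depths at
  -- most a.
  | k + 1 => if h : k < a then some (i, ⟨k, h⟩) else none

theorem vtx_zero (i : Fin b) : (vtx i 0 : Option (Fin b × Fin a)) = none := rfl

theorem vtx_succ (i : Fin b) {k : ℕ} (h : k < a) :
    (vtx i (k + 1) : Option (Fin b × Fin a)) = some (i, ⟨k, h⟩) := dif_pos h

theorem vtx_val (i : Fin b) (k : Fin a) : vtx i (k + 1) = some (i, k) := vtx_succ i k.2

theorem exists_vtx (hb : 0 < b) (x : Option (Fin b × Fin a)) :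
    ∃ i, ∃ k ≤ a, x = vtx i k := by
  rcases x with _ | ⟨i, k⟩
  · exact ⟨⟨0, hb⟩, 0, Nat.zero_le _, rfl⟩
  · exact ⟨i, k + 1, k.2, (vtx_val i k).symm⟩

theorem vtx_eq_vtx {i j : Fin b} {k l : ℕ} (hk : k ≤ a) (hl : l ≤ a) :
    (vtx i k : Option (Fin b × Fin a)) = vtx j l ↔ k = l ∧ (k = 0 ∨ i = j) := by
  rcases k with _ | k <;> rcases l with _ | l
  · simp [vtx_zero]
  · rw [vtx_zero, vtx_succ j hl]; simp
  · rw [vtx_zero, vtx_succ i hk]; simp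
  · rw [vtx_succ i hk, vtx_succ j hl]
    simp only [Option.some.injEq, Prod.mk.injEq, Fin.mk.injEq]
    omega

theorem spider_adj_none_some (i : Fin b) (k : Fin a) :
    (spider a b).Adj none (some (i, k)) ↔ (k : ℕ) = 0 := by
  simp [spider, SimpleGraph.fromRel_adj]

theorem spider_adj_some_some (i j : Fin b) (k l : Fin a) :
    (spider a b).Adj (some (i, k)) (some (j, l)) ↔
      i = j ∧ ((l : ℕ) = k + 1 ∨ (k : ℕ) = l + 1) := by
  simp only [spider, SimpleGraph.fromRel_adj, ne_eq, Option.some.injEq, Prod.mk.injEq,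
    Fin.ext_iff]
  omega

theorem sum_spider (H : Option (Fin b × Fin a) → ℝ) :
    ∑ x, H x = H none + ∑ i, ∑ k ∈ Finset.range a, H (vtx i (k + 1)) := by
  rw [Fintype.sum_option, Fintype.sum_prod_type]
  congr 1
  refine Finset.sum_congr rfl fun i _ => ?_
  rw [Finset.sum_range]
  exact Finset.sum_congr rfl fun k _ => by rw [vtx_val]

theorem sum_adjWeight_none (ha : 0 < a) (F : Option (Fin b × Fin a) → ℝ) :
    ∑ y, adjWeight (spider a b) none y * F y = ∑ i, F (vtx i 1) := by
  rw [sum_spider]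
  have h0 : adjWeight (spider a b) none none = 0 := by simp [adjWeight]
  rw [h0, zero_mul, zero_add]
  refine Finset.sum_congr rfl fun i _ => ?_
  rw [Finset.sum_eq_single_of_mem 0 (Finset.mem_range.2 ha)]
  · rw [vtx_succ i ha, adjWeight, if_pos ((spider_adj_none_some i _).2 rfl), one_mul]
  · intro k hk hk0
    rw [vtx_succ i (Finset.mem_range.1 hk), adjWeight,
      if_neg fun h => hk0 ((spider_adj_none_some i _).1 h), zero_mul]

theorem sum_adjWeight_vtx (i : Fin b) {k : ℕ} (hk : k < a) (F : Option (Fin b × Fin a) → ℝ) :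
    ∑ y, adjWeight (spider a b) (vtx i (k + 1)) y * F y =
      F (vtx i k) + if k + 1 < a then F (vtx i (k + 2)) else 0 := by
  classical
  rw [sum_spider, adjWeight_comm]
  have h1 : ∀ j, ∑ l ∈ Finset.range a,
      adjWeight (spider a b) (vtx i (k + 1)) (vtx j (l + 1)) * F (vtx j (l + 1)) =
      if i = j then ∑ l ∈ Finset.range a, ((if k + 1 = l then F (vtx j (l + 1)) else 0) +
        (if k = l + 1 then F (vtx j (l + 1)) else 0)) else 0 := by
    intro j
    split_ifs with hij
    · refine Finset.sum_congr rfl fun l hl => ?_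
      rw [vtx_succ i hk, vtx_succ j (Finset.mem_range.1 hl), adjWeight]
      simp only [spider_adj_some_some, hij, true_and]
      by_cases h2 : k + 1 = l
      · rw [if_pos (Or.inl h2.symm), if_pos h2, if_neg (by omega)]; ring
      · by_cases h3 : k = l + 1
        · rw [if_pos (Or.inr h3), if_neg h2, if_pos h3]; ring
        · rw [if_neg (by omega), if_neg h2, if_neg h3]; ring
    · refine Finset.sum_eq_zero fun l hl => ?_
      rw [vtx_succ i hk, vtx_succ j (Finset.mem_range.1 hl), adjWeight,
        if_neg fun h => hij ((spider_adj_some_some _ _ _ _).1 h).1, zero_mul]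
  rw [Finset.sum_congr rfl fun j _ => h1 j, Finset.sum_ite_eq, if_pos (Finset.mem_univ i),
    Finset.sum_add_distrib, Finset.sum_ite_eq]
  simp only [Finset.mem_range]
  rw [vtx_succ i hk, adjWeight]
  simp only [spider_adj_none_some]
  rcases k with _ | k
  · simp [vtx_zero]
  · have h2 : ∀ l, (if k + 1 = l + 1 then F (vtx i (l + 1)) else 0) =
        if k = l then F (vtx i (l + 1)) else 0 := fun l => by simp
    rw [Finset.sum_congr rfl fun l _ => h2 l, Finset.sum_ite_eq,
      if_pos (Finset.mem_range.2 (by omega))]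
    simp
    ring

theorem wdeg_none (ha : 0 < a) : wdeg (spider a b) none = b := by
  have := sum_adjWeight_none (b := b) ha (fun _ => 1)
  simpa [wdeg] using this

theorem wdeg_vtx (i : Fin b) {k : ℕ} (hk : k < a) :
    wdeg (spider a b) (vtx i (k + 1)) = 1 + if k + 1 < a then 1 else 0 := by
  have := sum_adjWeight_vtx i hk (fun _ => 1)
  simpa [wdeg] using this

theorem wdeg_spider_pos (ha : 0 < a) (hb : 0 < b) (x : Option (Fin b × Fin a)) :
    0 < wdeg (spider a b) x := by
  rcases x with _ | ⟨i, k⟩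
  · rw [wdeg_none ha]; exact_mod_cast hb
  · rw [← vtx_val, wdeg_vtx i k.2]
    split_ifs <;> norm_num

/-- A degree weight counts a vertex once for each incident edge, and the edges are partitioned by
the legs; the weight b of the center is shared out among them. -/
theorem sum_wdeg_mul (ha : 0 < a) (F : Option (Fin b × Fin a) → ℝ) :
    ∑ x, wdeg (spider a b) x * F x = ∑ i, edgeSum a (fun k => F (vtx i k)) := by
  rw [sum_spider, wdeg_none ha]
  simp only [edgeSum_eq ha, Finset.sum_add_distrib, vtx_zero]
  rw [Finset.sum_const, Finset.card_univ, Fintype.card_fin, nsmul_eq_mul]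
  congr 1
  refine Finset.sum_congr rfl fun i _ => Finset.sum_congr rfl fun k hk => ?_
  rw [wdeg_vtx i (Finset.mem_range.1 hk)]

/-- The distance between two vertices of the spider. -/
noncomputable def spiderDist : Option (Fin b × Fin a) → Option (Fin b × Fin a) → ℝ
  | none, none => 0
  | none, some (_, k) => k + 1
  | some (_, k), none => k + 1
  | some (i, k), some (j, l) => if i = j then |(k : ℝ) - l| else k + l + 2

theorem spiderDist_vtx (i j : Fin b) {k l : ℕ} (hk : k ≤ a) (hl : l ≤ a) :
    spiderDist (vtx i k : Option (Fin b × Fin a)) (vtx j l) =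
      if i = j then |(k : ℝ) - l| else k + l := by
  rcases k with _ | k <;> rcases l with _ | l
  · simp [vtx_zero, spiderDist]
  · rw [vtx_zero, vtx_succ j hl]
    simp only [spiderDist]
    push_cast
    rw [zero_sub, abs_neg, abs_of_nonneg (by positivity)]
    simp
  · rw [vtx_zero, vtx_succ i hk]
    simp only [spiderDist]
    push_cast
    rw [sub_zero, abs_of_nonneg (by positivity)]
    simp
  · rw [vtx_succ i hk, vtx_succ j hl]
    simp only [spiderDist]
    push_cast
    split_ifs
    · congr 1; ring
    · ring

theorem spiderDist_nonneg (x y : Option (Fin b × Fin a)) : 0 ≤ spiderDist x y := by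
  rcases x with _ | ⟨i, k⟩ <;> rcases y with _ | ⟨j, l⟩ <;> simp only [spiderDist] <;>
    (try split_ifs) <;> positivity

/-- In a tree, exactly one neighbor of x ≠ z is nearer to z and all others are farther, so the
Laplacian of the distance to z is 1 - (deg x - 1) = 2 - deg x. At x = z it is -deg x, which is 2
less. -/
theorem isResistance_spiderDist (ha : 0 < a) (hb : 0 < b) :
    IsResistance (spider a b) spiderDist := by
  classical
  refine ⟨?_, ?_, fun x => 2 - wdeg (spider a b) x, ?_⟩
  · rintro (_ | ⟨i, k⟩) <;> simp [spiderDist]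
  · rintro (_ | ⟨i, k⟩) (_ | ⟨j, l⟩) <;> simp only [spiderDist]
    simp only [eq_comm (a := i), abs_sub_comm (k : ℝ), add_comm (k : ℝ)]
  · intro x z
    obtain ⟨j, l, hl, rfl⟩ := exists_vtx hb z
    rcases x with _ | ⟨i, k⟩
    · beta_reduce
      rw [sum_adjWeight_none ha, wdeg_none ha, ← vtx_zero j]
      simp only [spiderDist_vtx _ _ (Nat.zero_le a) hl, spiderDist_vtx _ _ (Nat.succ_le_of_lt ha) hl,
        vtx_eq_vtx (Nat.zero_le a) hl]
      rcases l with _ | l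
      · simp
      · have h1 : |((0 : ℕ) : ℝ) - (l + 1 : ℕ)| = l + 1 := by
          push_cast
          rw [zero_sub, abs_neg, abs_of_nonneg (by positivity)]
        have h2 : |((Nat.succ 0 : ℕ) : ℝ) - (l + 1 : ℕ)| = l := by
          push_cast
          rw [show (1 : ℝ) - (l + 1) = -l by ring, abs_neg, abs_of_nonneg (by positivity)]
        rw [sum_eq_of_forall_ne j _ (-1)]
        · simp only [h1, h2, if_true, Fintype.card_fin]
          rw [if_neg (by omega)]
          ring
        · intro i hij
          simp only [h1, if_neg hij]
          push_cast
          ring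
    · obtain ⟨k, hk⟩ := k
      beta_reduce
      rw [← vtx_succ i hk, sum_adjWeight_vtx i hk, wdeg_vtx i hk]
      have hk1 : k + 1 ≤ a := hk
      simp only [spiderDist_vtx _ _ hk1 hl, spiderDist_vtx _ _ hk.le hl]
      have hz : (vtx i (k + 1) : Option (Fin b × Fin a)) = vtx j l ↔ l = k + 1 ∧ i = j := by
        rw [vtx_eq_vtx hk1 hl]
        omega
      simp only [hz]
      -- The outer neighbor exists only under the guard, so its distance formula may be substituted
      -- only inside the `if`.
      have hf : (if k + 1 < a then (if i = j then |((k + 1 : ℕ) : ℝ) - l| else (k + 1 : ℕ) + l) -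
          spiderDist (vtx i (k + 2) : Option (Fin b × Fin a)) (vtx j l) else 0) =
          if k + 1 < a then (if i = j then |((k + 1 : ℕ) : ℝ) - l| else (k + 1 : ℕ) + l) -
          (if i = j then |((k + 2 : ℕ) : ℝ) - l| else (k + 2 : ℕ) + l) else 0 := by
        split_ifs with h1 h2
        · rw [spiderDist_vtx _ _ h1 hl, if_pos h2]
        · rw [spiderDist_vtx _ _ h1 hl, if_neg h2]
        · rfl
      rw [hf]
      push_cast
      by_cases hij : i = j
      · simp only [hij, if_true, and_true]
        rcases lt_trichotomy l (k + 1) with h | h | h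
        · have h1 : (l : ℝ) ≤ k := by exact_mod_cast Nat.lt_succ_iff.1 h
          rw [abs_of_nonneg (by linarith), abs_of_nonneg (by linarith),
            abs_of_nonneg (by linarith), if_neg (show ¬ l = k + 1 by omega)]
          split_ifs <;> ring
        · have h1 : (l : ℝ) = k + 1 := by exact_mod_cast h
          rw [if_pos h, h1]
          norm_num
          split_ifs <;> norm_num
        · have h1 : (k : ℝ) + 2 ≤ l := by exact_mod_cast h
          have h2 : k + 1 < a := by omega
          rw [abs_of_nonpos (by linarith), abs_of_nonpos (by linarith),
            abs_of_nonpos (by linarith), if_neg (show ¬ l = k + 1 by omega), if_pos h2, if_pos h2]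
          ring
      · simp only [hij, and_false, if_false]
        split_ifs <;> ring

end Spider

/-! ### The Braess criterion for pairs of spider vertices. -/

section SpiderEdges

variable {a b : ℕ}

theorem sum_wdeg_spider (ha : 0 < a) :
    ∑ x, wdeg (spider a b) x = 2 * (a * b : ℝ) := by
  have h := sum_wdeg_mul (a := a) (b := b) ha (fun _ => 1)
  simp only [mul_one] at h
  rw [h]
  simp only [edgeSum_quadratic (n := a) (f := fun _ => (1 : ℝ)) 1 0 0 (by intros; ring)]
  simp
  ring

theorem sum_wdeg_mul_spiderDist (ha : 0 < a) (i : Fin b) {s : ℕ} (hs : s ≤ a) :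
    ∑ x, wdeg (spider a b) x * spiderDist x (vtx i s) =
      b * (a : ℝ) ^ 2 + 2 * a * (b - 2) * s + 2 * (s : ℝ) ^ 2 := by
  rw [sum_wdeg_mul ha, sum_eq_of_forall_ne i _ ((a : ℝ) ^ 2 + 2 * s * a), Fintype.card_fin]
  · obtain ⟨t, rfl⟩ := Nat.exists_eq_add_of_le hs
    rw [edgeSum_add, edgeSum_quadratic (n := s) s (-1) 0, edgeSum_quadratic (n := t) 0 1 0]
    · push_cast
      ring
    · intro k hk
      rw [spiderDist_vtx _ _ (by omega) hs, if_pos rfl, Nat.cast_add, abs_of_nonneg (by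
        rw [add_sub_cancel_left]; positivity)]
      ring
    · intro k hk
      have : (k : ℝ) ≤ s := by exact_mod_cast hk
      rw [spiderDist_vtx _ _ (by omega) hs, if_pos rfl, abs_of_nonpos (by linarith)]
      ring
  · intro j hj
    rw [edgeSum_quadratic (n := a) s 1 0]
    · ring
    · intro k hk
      rw [spiderDist_vtx _ _ hk hs, if_neg hj]
      ring

theorem gutman_spiderDist (ha : 0 < a) (hb : 0 < b) :
    gutman (spider a b) spiderDist =
      a * b * (4 * (a : ℝ) ^ 2 * b - 8 / 3 * (a : ℝ) ^ 2 + 2 / 3) := by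
  unfold gutman
  rw [sum_wdeg_mul ha]
  have h1 : ∀ i : Fin b, edgeSum a (fun k => ∑ y, wdeg (spider a b) y *
      spiderDist (vtx i k : Option (Fin b × Fin a)) y) =
      2 * (b * (a : ℝ) ^ 2) * a + (2 * a * (b - 2)) * (a : ℝ) ^ 2 +
        2 * (a * (2 * (a : ℝ) ^ 2 + 1) / 3) := by
    intro i
    refine edgeSum_quadratic _ _ _ fun k hk => ?_
    rw [← sum_wdeg_mul_spiderDist ha i hk]
    exact Finset.sum_congr rfl fun y _ => by rw [(isResistance_spiderDist ha hb).symm]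
  rw [Finset.sum_congr rfl fun i _ => h1 i, Finset.sum_const, Finset.card_univ, Fintype.card_fin,
    nsmul_eq_mul]
  ring

/-- The sign of this expression decides whether the pair of vertices at distances `p` and `p + r`
from the end of the same leg of the spider is a Braess edge. -/
noncomputable def excess (a b r p : ℝ) : ℝ :=
  8 * a * (b - 2) * ((1 + r) * (a - r * (r + 2) / 3) - p * (r ^ 2 + r + 1)) +
    8 / 3 * (1 + r) * (2 * a) * (2 * a - r * (r + 2)) + 2 / 3 * (r + 1) ^ 3 * (3 * r - 1) -
    8 * (r ^ 2 + r + 1) * p * (2 * a - r - p)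

section SameLeg

variable (i : Fin b) (x r p : ℕ)

theorem potential_same_leg (ha : a = x + r + p) (j : Fin b) {k : ℕ} (hk : k ≤ a) :
    potential spiderDist (vtx i x : Option (Fin b × Fin a)) (vtx i (x + r)) (vtx j k) =
      if j = i then (|(k : ℝ) - x| - |(k : ℝ) - (x + r)|) / 2 else -r / 2 := by
  unfold potential
  rw [spiderDist_vtx _ _ hk (by omega), spiderDist_vtx _ _ hk (by omega)]
  push_cast
  split_ifs
  · rfl
  · ring

/-- The current flows only between the two vertices: the potential has slope 1 there and is constant
on either side. -/
theorem potential_same_leg_pieces (ha : a = x + r + p) :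
    (∀ k ≤ x, potential spiderDist (vtx i x : Option (Fin b × Fin a)) (vtx i (x + r)) (vtx i k) =
      -r / 2) ∧
    (∀ k ≤ r, potential spiderDist (vtx i x : Option (Fin b × Fin a)) (vtx i (x + r))
      (vtx i (x + k)) = k - r / 2) ∧
    (∀ k ≤ p, potential spiderDist (vtx i x : Option (Fin b × Fin a)) (vtx i (x + r))
      (vtx i (x + r + k)) = r / 2) := by
  refine ⟨fun k hk => ?_, fun k hk => ?_, fun k hk => ?_⟩
  · have : (k : ℝ) ≤ x := by exact_mod_cast hk
    rw [potential_same_leg i x r p ha i (by omega), if_pos rfl, abs_of_nonpos (by linarith),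
      abs_of_nonpos (by linarith [Nat.cast_nonneg (α := ℝ) r])]
    ring
  · have : (k : ℝ) ≤ r := by exact_mod_cast hk
    rw [potential_same_leg i x r p ha i (by omega), if_pos rfl]
    push_cast
    rw [abs_of_nonneg (by linarith [Nat.cast_nonneg (α := ℝ) k]), abs_of_nonpos (by linarith)]
    ring
  · rw [potential_same_leg i x r p ha i (by omega), if_pos rfl]
    push_cast
    rw [abs_of_nonneg (by linarith [Nat.cast_nonneg (α := ℝ) k, Nat.cast_nonneg (α := ℝ) r]),
      abs_of_nonneg (by linarith [Nat.cast_nonneg (α := ℝ) k])]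
    ring

theorem sum_wdeg_mul_potential_same_leg (ha0 : 0 < a) (ha : a = x + r + p) :
    ∑ y, wdeg (spider a b) y *
        potential spiderDist (vtx i x : Option (Fin b × Fin a)) (vtx i (x + r)) y =
      r * (2 * p + r - a * b) := by
  obtain ⟨h1, h2, h3⟩ := potential_same_leg_pieces (a := a) i x r p ha
  rw [sum_wdeg_mul ha0, sum_eq_of_forall_ne i _ (-(r : ℝ) * a), Fintype.card_fin]
  · conv_lhs => rw [ha]
    rw [edgeSum_add, edgeSum_add]
    rw [edgeSum_quadratic (n := x) (-r / 2) 0 0, edgeSum_quadratic (n := r) (-r / 2) 1 0,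
      edgeSum_quadratic (n := p) (r / 2) 0 0]
    · rw [ha]; push_cast; ring
    · intro k hk; rw [ha] at h3; rw [h3 k hk]; ring
    · intro k hk; rw [ha] at h2; rw [h2 k hk]; ring
    · intro k hk; rw [ha] at h1; rw [h1 k hk]; ring
  · intro j hj
    rw [edgeSum_quadratic (n := a) (-r / 2) 0 0]
    · ring
    · intro k hk
      rw [potential_same_leg i x r p ha j hk, if_neg hj]
      ring

theorem sum_wdeg_mul_potential_sq_same_leg (ha0 : 0 < a) (ha : a = x + r + p) :
    ∑ y, wdeg (spider a b) y *
        potential spiderDist (vtx i x : Option (Fin b × Fin a)) (vtx i (x + r)) y ^ 2 =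
      (r : ℝ) ^ 2 / 2 * (a * b - r) + r * ((r : ℝ) ^ 2 + 2) / 6 := by
  obtain ⟨h1, h2, h3⟩ := potential_same_leg_pieces (a := a) i x r p ha
  rw [sum_wdeg_mul ha0, sum_eq_of_forall_ne i _ ((r : ℝ) ^ 2 / 2 * a), Fintype.card_fin]
  · conv_lhs => rw [ha]
    rw [edgeSum_add, edgeSum_add]
    rw [edgeSum_quadratic (n := x) (r ^ 2 / 4) 0 0,
      edgeSum_quadratic (n := r) (r ^ 2 / 4) (-r) 1,
      edgeSum_quadratic (n := p) (r ^ 2 / 4) 0 0]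
    · rw [ha]; push_cast; ring
    · intro k hk; rw [ha] at h3; rw [h3 k hk]; ring
    · intro k hk; rw [ha] at h2; rw [h2 k hk]; ring
    · intro k hk; rw [ha] at h1; rw [h1 k hk]; ring
  · intro j hj
    rw [edgeSum_quadratic (n := a) (r ^ 2 / 4) 0 0]
    · ring
    · intro k hk
      rw [potential_same_leg i x r p ha j hk, if_neg hj]
      ring

theorem isBraessEdge_same_leg (hb : 0 < b) (hr : 2 ≤ r) (ha : a = x + r + p) :
    IsBraessEdge (spider a b) s(vtx i x, vtx i (x + r)) ↔ 0 < excess a b r p := by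
  have ha0 : 0 < a := by omega
  have hx : x ≤ a := by omega
  have hxr : x + r ≤ a := by omega
  have hne : (vtx i x : Option (Fin b × Fin a)) ≠ vtx i (x + r) := by
    rw [ne_eq, vtx_eq_vtx hx hxr]; omega
  have hadj : ¬ (spider a b).Adj (vtx i x) (vtx i (x + r)) := by
    obtain ⟨s, hs⟩ : ∃ s, x + r = s + 1 := ⟨x + r - 1, by omega⟩
    rw [hs, vtx_succ i (show s < a by omega)]
    rcases x with _ | x
    · rw [vtx_zero, spider_adj_none_some]
      simp only; omega
    · rw [vtx_succ i hx, spider_adj_some_some]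
      simp only; omega
  have hd : spiderDist (vtx i x : Option (Fin b × Fin a)) (vtx i (x + r)) = r := by
    rw [spiderDist_vtx _ _ hx hxr, if_pos rfl]
    push_cast
    rw [sub_add_cancel_left, abs_neg, abs_of_nonneg (by positivity)]
  rw [isBraessEdge_iff (isResistance_spiderDist ha0 hb) (wdeg_spider_pos ha0 hb) hne hadj
    (by rw [hd]; positivity), sum_wdeg_spider ha0, gutman_spiderDist ha0 hb,
    sum_wdeg_mul_spiderDist ha0 i hx, sum_wdeg_mul_spiderDist ha0 i hxr,
    sum_wdeg_mul_potential_same_leg i x r p ha0 ha,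
    sum_wdeg_mul_potential_sq_same_leg i x r p ha0 ha, hd]
  -- The quantity in `isBraessEdge_iff` is this positive factor times `excess a b r p`.
  have hpos : (0 : ℝ) < 2 * (a * b) / (1 + r) := by positivity
  rw [← mul_pos_iff_of_pos_left (b := excess a b r p) hpos]
  have hr1 : (1 : ℝ) + r ≠ 0 := by positivity
  have hx' : (x : ℝ) = a - r - p := by rw [ha]; push_cast; ring
  refine iff_of_eq (congrArg _ ?_)
  unfold excess
  push_cast
  rw [hx']
  field_simp
  ring

end SameLeg

section DifferentLegs

variable {i j : Fin b} (s t : ℕ)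

theorem potential_different_legs (hij : i ≠ j) (hs : s ≤ a) (ht : t ≤ a) (l : Fin b) {k : ℕ}
    (hk : k ≤ a) :
    potential spiderDist (vtx i s : Option (Fin b × Fin a)) (vtx j t) (vtx l k) =
      if l = i then (|(k : ℝ) - s| - (k + t)) / 2 else
        if l = j then (k + s - |(k : ℝ) - t|) / 2 else ((s : ℝ) - t) / 2 := by
  unfold potential
  rw [spiderDist_vtx _ _ hk hs, spiderDist_vtx _ _ hk ht]
  by_cases h1 : l = i
  · rw [if_pos h1, if_pos h1, if_neg (by rw [h1]; exact hij)]
  · rw [if_neg h1, if_neg h1]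
    split_ifs <;> ring

theorem potential_different_legs_pieces (hij : i ≠ j) (hs : s ≤ a) (ht : t ≤ a) :
    (∀ k ≤ s, potential spiderDist (vtx i s : Option (Fin b × Fin a)) (vtx j t) (vtx i k) =
      (s - t) / 2 - k) ∧
    (∀ k, s + k ≤ a → potential spiderDist (vtx i s : Option (Fin b × Fin a)) (vtx j t)
      (vtx i (s + k)) = -(s + t) / 2) ∧
    (∀ k ≤ t, potential spiderDist (vtx i s : Option (Fin b × Fin a)) (vtx j t) (vtx j k) =
      (s - t) / 2 + k) ∧
    (∀ k, t + k ≤ a → potential spiderDist (vtx i s : Option (Fin b × Fin a)) (vtx j t)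
      (vtx j (t + k)) = (s + t) / 2) := by
  refine ⟨fun k hk => ?_, fun k hk => ?_, fun k hk => ?_, fun k hk => ?_⟩
  · have : (k : ℝ) ≤ s := by exact_mod_cast hk
    rw [potential_different_legs s t hij hs ht i (by omega), if_pos rfl,
      abs_of_nonpos (by linarith)]
    ring
  · rw [potential_different_legs s t hij hs ht i hk, if_pos rfl]
    push_cast
    rw [abs_of_nonneg (by linarith [Nat.cast_nonneg (α := ℝ) k])]
    ring
  · have : (k : ℝ) ≤ t := by exact_mod_cast hk
    rw [potential_different_legs s t hij hs ht j (by omega), if_neg hij.symm, if_pos rfl,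
      abs_of_nonpos (by linarith)]
    ring
  · rw [potential_different_legs s t hij hs ht j hk, if_neg hij.symm, if_pos rfl]
    push_cast
    rw [abs_of_nonneg (by linarith [Nat.cast_nonneg (α := ℝ) k])]
    ring

theorem sum_wdeg_mul_potential_different_legs (ha : 0 < a) (hij : i ≠ j) (hs : s ≤ a)
    (ht : t ≤ a) :
    ∑ y, wdeg (spider a b) y *
        potential spiderDist (vtx i s : Option (Fin b × Fin a)) (vtx j t) y =
      (s - t) * (s + t + (b - 2) * a) := by
  obtain ⟨h1, h2, h3, h4⟩ := potential_different_legs_pieces (a := a) s t hij hs ht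
  rw [sum_wdeg_mul ha, sum_eq_of_forall_ne_ne hij _ (((s : ℝ) - t) * a), Fintype.card_fin]
  · obtain ⟨p, hp⟩ := Nat.exists_eq_add_of_le hs
    obtain ⟨q, hq⟩ := Nat.exists_eq_add_of_le ht
    have e1 : edgeSum a (fun k => potential spiderDist
        (vtx i s : Option (Fin b × Fin a)) (vtx j t) (vtx i k)) = -s * t - (s + t) * p := by
      have : ∀ f, edgeSum a f = edgeSum (s + p) f := fun f => by rw [← hp]
      rw [this, edgeSum_add, edgeSum_quadratic (n := s) ((s - t) / 2) (-1) 0,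
        edgeSum_quadratic (n := p) (-(s + t) / 2) 0 0]
      · ring
      · intro k hk; rw [h2 k (by omega)]; ring
      · intro k hk; rw [h1 k hk]; ring
    have e2 : edgeSum a (fun k => potential spiderDist
        (vtx i s : Option (Fin b × Fin a)) (vtx j t) (vtx j k)) = s * t + (s + t) * q := by
      have : ∀ f, edgeSum a f = edgeSum (t + q) f := fun f => by rw [← hq]
      rw [this, edgeSum_add, edgeSum_quadratic (n := t) ((s - t) / 2) 1 0,
        edgeSum_quadratic (n := q) ((s + t) / 2) 0 0]
      · ring
      · intro k hk; rw [h4 k (by omega)]; ring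
      · intro k hk; rw [h3 k hk]; ring
    have hp' : (p : ℝ) = a - s := by rw [hp]; push_cast; ring
    have hq' : (q : ℝ) = a - t := by rw [hq]; push_cast; ring
    rw [e1, e2, hp', hq']
    ring
  · intro l hl hl'
    rw [edgeSum_quadratic (n := a) (((s : ℝ) - t) / 2) 0 0]
    · ring
    · intro k hk
      rw [potential_different_legs s t hij hs ht l hk, if_neg hl, if_neg hl']
      ring

theorem sum_wdeg_mul_potential_sq_different_legs (ha : 0 < a) (hij : i ≠ j) (hs : s ≤ a)
    (ht : t ≤ a) :
    ∑ y, wdeg (spider a b) y *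
        potential spiderDist (vtx i s : Option (Fin b × Fin a)) (vtx j t) y ^ 2 =
      ((s : ℝ) + t) ^ 2 / 2 * (2 * a - (s + t)) + (s + t) * (((s : ℝ) + t) ^ 2 + 2) / 6 +
        (b - 2) * a * ((s : ℝ) - t) ^ 2 / 2 := by
  obtain ⟨h1, h2, h3, h4⟩ := potential_different_legs_pieces (a := a) s t hij hs ht
  rw [sum_wdeg_mul ha, sum_eq_of_forall_ne_ne hij _ (((s : ℝ) - t) ^ 2 / 2 * a),
    Fintype.card_fin]
  · obtain ⟨p, hp⟩ := Nat.exists_eq_add_of_le hs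
    obtain ⟨q, hq⟩ := Nat.exists_eq_add_of_le ht
    have e1 : edgeSum a (fun k => potential spiderDist
        (vtx i s : Option (Fin b × Fin a)) (vtx j t) (vtx i k) ^ 2) =
        ((s : ℝ) - t) ^ 2 / 2 * s - (s - t) * (s : ℝ) ^ 2 + s * (2 * (s : ℝ) ^ 2 + 1) / 3 +
          ((s : ℝ) + t) ^ 2 / 2 * p := by
      have : ∀ f, edgeSum a f = edgeSum (s + p) f := fun f => by rw [← hp]
      rw [this, edgeSum_add, edgeSum_quadratic (n := s) (((s : ℝ) - t) ^ 2 / 4) (-(s - t)) 1,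
        edgeSum_quadratic (n := p) (((s : ℝ) + t) ^ 2 / 4) 0 0]
      · ring
      · intro k hk; rw [h2 k (by omega)]; ring
      · intro k hk; rw [h1 k hk]; ring
    have e2 : edgeSum a (fun k => potential spiderDist
        (vtx i s : Option (Fin b × Fin a)) (vtx j t) (vtx j k) ^ 2) =
        ((s : ℝ) - t) ^ 2 / 2 * t + (s - t) * (t : ℝ) ^ 2 + t * (2 * (t : ℝ) ^ 2 + 1) / 3 +
          ((s : ℝ) + t) ^ 2 / 2 * q := by
      have : ∀ f, edgeSum a f = edgeSum (t + q) f := fun f => by rw [← hq]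
      rw [this, edgeSum_add, edgeSum_quadratic (n := t) (((s : ℝ) - t) ^ 2 / 4) (s - t) 1,
        edgeSum_quadratic (n := q) (((s : ℝ) + t) ^ 2 / 4) 0 0]
      · ring
      · intro k hk; rw [h4 k (by omega)]; ring
      · intro k hk; rw [h3 k hk]; ring
    have hp' : (p : ℝ) = a - s := by rw [hp]; push_cast; ring
    have hq' : (q : ℝ) = a - t := by rw [hq]; push_cast; ring
    rw [e1, e2, hp', hq']
    ring
  · intro l hl hl'
    rw [edgeSum_quadratic (n := a) (((s : ℝ) - t) ^ 2 / 4) 0 0]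
    · ring
    · intro k hk
      rw [potential_different_legs s t hij hs ht l hk, if_neg hl, if_neg hl']
      ring

/-- The scaled decrease of Kemeny's constant of the spider with `c + 2` legs of length
`(z + r) / 2` when vertices at distance `r` on different legs, with squared depth difference `W`,
are joined. -/
theorem different_legs_nonneg {r z W c : ℝ} (hr : 2 ≤ r) (hz : 0 ≤ z) (hrz : 4 ≤ z + r)
    (hr34 : r ≤ 3 ∨ 4 ≤ r) (hW0 : 0 ≤ W) (hW : W ≤ z * r) (hc : 0 ≤ c) :
    0 ≤ (2 * (z + r + 1) * (r ^ 2 * (z + 1) + r * (r ^ 2 + 2) / 3) - 2 * W * r ^ 2 -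
        (1 + r) * (2 / 3 * (z + r) ^ 2 - 2 / 3 + 2 * (r ^ 2 + W) + 2 * r)) +
      c * ((z + r) / 2) * (2 * r ^ 2 * (z + 1) + 2 / 3 * r * (r ^ 2 + 2) +
        W * (2 * z + 2 - 2 * r) - 4 * r * (1 + r)) := by
  have h0 : 0 ≤ 2 * (z + r + 1) * (r ^ 2 * (z + 1) + r * (r ^ 2 + 2) / 3) - 2 * W * r ^ 2 -
        (1 + r) * (2 / 3 * (z + r) ^ 2 - 2 / 3 + 2 * (r ^ 2 + W) + 2 * r) := by
    have e : 2 * (z + r + 1) * (r ^ 2 * (z + 1) + r * (r ^ 2 + 2) / 3) - 2 * W * r ^ 2 -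
        (1 + r) * (2 / 3 * (z + r) ^ 2 - 2 / 3 + 2 * (r ^ 2 + W) + 2 * r) =
        2 * (r ^ 2 + r + 1) * (z * r - W) + (2 * r ^ 2 - 2 / 3 * (1 + r)) * z ^ 2 +
          (2 / 3 * r ^ 3 + 2 / 3 * r ^ 2 - 2 * r) * z + 2 / 3 * (r ^ 2 - 1) ^ 2 := by ring
    rw [e]
    have h1 : 0 ≤ 2 * r ^ 2 - 2 / 3 * (1 + r) := by nlinarith
    have h2 : 0 ≤ 2 / 3 * r ^ 3 + 2 / 3 * r ^ 2 - 2 * r := by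
      have : 0 ≤ r * (r ^ 2 + r - 3) := mul_nonneg (by linarith) (by nlinarith)
      nlinarith
    have h3 : 0 ≤ z * r - W := by linarith
    positivity
  -- The coefficient of c * ((z + r) / 2) is affine in W, so it suffices to check it at W = 0 and at
  -- W = z * r. Up to the factor 2r these values are the expressions in `h1` and `h2`.
  have h1 : 0 ≤ r * z + r ^ 2 / 3 - r - 4 / 3 := by
    rcases le_total 4 r with h | h
    · nlinarith [mul_nonneg (by linarith : 0 ≤ r) hz,
        mul_nonneg (by linarith : 0 ≤ r - 4) (by linarith : 0 ≤ r + 1)]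
    · nlinarith [mul_nonneg (by linarith : 0 ≤ r) (by linarith : 0 ≤ z + r - 4),
        mul_nonneg (by linarith : 0 ≤ r - 2) (by linarith : 0 ≤ 4 - r)]
  have h2 : 0 ≤ z ^ 2 + z + r ^ 2 / 3 - r - 4 / 3 := by
    -- The inequality fails for r slightly below 4 with z + r = 4; integrality of the distance
    -- excludes that range.
    rcases hr34 with h | h
    · nlinarith [mul_nonneg (by linarith : 0 ≤ z + r - 4) (by linarith : 0 ≤ z + 5 - r),
        mul_nonneg (by linarith : 0 ≤ 4 - r) (by linarith : 0 ≤ 14 - 4 * r)]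
    · nlinarith [mul_nonneg (by linarith : 0 ≤ r - 4) (by linarith : 0 ≤ r + 1)]
  have h3 : 0 ≤ 2 * r ^ 2 * (z + 1) + 2 / 3 * r * (r ^ 2 + 2) +
        W * (2 * z + 2 - 2 * r) - 4 * r * (1 + r) := by
    rcases le_total 0 (2 * z + 2 - 2 * r) with h | h
    · have := mul_nonneg hW0 h
      nlinarith [mul_nonneg (by linarith : 0 ≤ 2 * r) h1]
    · have := mul_nonneg_of_nonpos_of_nonpos (by linarith : W - z * r ≤ 0) h
      nlinarith [mul_nonneg (by linarith : 0 ≤ 2 * r) h2]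
  have : 0 ≤ c * ((z + r) / 2) := by positivity
  positivity

theorem not_isBraessEdge_different_legs (ha : 2 ≤ a) (hb : 2 ≤ b) (hij : i ≠ j) (hs0 : 0 < s)
    (ht0 : 0 < t) (hs : s ≤ a) (ht : t ≤ a) :
    ¬ IsBraessEdge (spider a b) s(vtx i s, vtx j t) := by
  have ha0 : 0 < a := by omega
  have hb0 : 0 < b := by omega
  have hne : (vtx i s : Option (Fin b × Fin a)) ≠ vtx j t := by
    rw [ne_eq, vtx_eq_vtx hs ht]; omega
  have hadj : ¬ (spider a b).Adj (vtx i s) (vtx j t) := by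
    obtain ⟨s, rfl⟩ := Nat.exists_eq_succ_of_ne_zero hs0.ne'
    obtain ⟨t, rfl⟩ := Nat.exists_eq_succ_of_ne_zero ht0.ne'
    rw [vtx_succ i hs, vtx_succ j ht, spider_adj_some_some]
    exact fun h => hij h.1
  have hd : spiderDist (vtx i s : Option (Fin b × Fin a)) (vtx j t) = s + t := by
    rw [spiderDist_vtx _ _ hs ht, if_neg hij]
  rw [isBraessEdge_iff (isResistance_spiderDist ha0 hb0) (wdeg_spider_pos ha0 hb0) hne hadj
    (by rw [hd]; positivity), sum_wdeg_spider ha0, gutman_spiderDist ha0 hb0,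
    sum_wdeg_mul_spiderDist ha0 i hs, sum_wdeg_mul_spiderDist ha0 j ht,
    sum_wdeg_mul_potential_different_legs s t ha0 hij hs ht,
    sum_wdeg_mul_potential_sq_different_legs s t ha0 hij hs ht, hd, not_lt]
  have hs' : (s : ℝ) ≤ a := by exact_mod_cast hs
  have ht' : (t : ℝ) ≤ a := by exact_mod_cast ht
  have hs1 : (1 : ℝ) ≤ s := by exact_mod_cast hs0
  have ht1 : (1 : ℝ) ≤ t := by exact_mod_cast ht0
  have ha' : (2 : ℝ) ≤ a := by exact_mod_cast ha
  have hb' : (2 : ℝ) ≤ b := by exact_mod_cast hb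
  have hint : (s : ℝ) + t ≤ 3 ∨ 4 ≤ (s : ℝ) + t := by
    have : s + t ≤ 3 ∨ 4 ≤ s + t := by omega
    exact_mod_cast this
  -- Here z * r - W = 2s(a - s) + 2t(a - t), which is nonnegative because neither depth exceeds a.
  have key := different_legs_nonneg (r := s + t) (z := 2 * a - (s + t)) (W := (s - t) ^ 2)
    (c := b - 2) (by linarith) (by linarith) (by linarith) hint (by positivity)
    (by nlinarith [mul_nonneg (by linarith : (0 : ℝ) ≤ s) (by linarith : (0 : ℝ) ≤ a - s),
      mul_nonneg (by linarith : (0 : ℝ) ≤ t) (by linarith : (0 : ℝ) ≤ a - t)]) (by linarith)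
  have hpos : (0 : ℝ) ≤ 2 * (a * b) / (1 + (s + t)) := by positivity
  have hr1 : (1 : ℝ) + (s + t) ≠ 0 := by positivity
  refine le_of_eq_of_le ?_ (neg_nonpos.2 (mul_nonneg hpos key))
  field_simp
  ring

end DifferentLegs

end SpiderEdges

/-! ### Sign of the excess, and comparison with the path. -/

section Excess

/-- With h = r(r+2)/3, there are two regimes. If a ≤ h, the part without p is already nonpositive.
If a ≥ h, the hypothesis bounds p below by some q, and p(2a - r - p) is no smaller than its value at
q, where r²+r+1 cancels. -/
theorem path_excess_nonpos {a r p : ℝ} (hr : 2 ≤ r) (hp : 0 ≤ p) (hrp : r + p ≤ a)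
    (hE : (1 + r) * (a - r * (r + 2) / 3) - p * (r ^ 2 + r + 1) ≤ 0) :
    excess a 2 r p ≤ 0 := by
  have hK : 0 < r ^ 2 + r + 1 := by positivity
  have hpoly : 9 * (r + 1) ^ 2 * (3 * r - 1) ≤ 8 * (r * (r + 2)) ^ 2 := by
    nlinarith [mul_nonneg (by linarith : 0 ≤ r - 2) (by positivity : 0 ≤ r ^ 3),
      mul_nonneg (by linarith : 0 ≤ r - 2) (by positivity : 0 ≤ r ^ 2),
      mul_nonneg (by linarith : 0 ≤ r - 2) (by linarith : 0 ≤ r)]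
  have e : excess a 2 r p = 2 / 3 * (1 + r) * (8 * a * (2 * a - r * (r + 2)) +
      (r + 1) ^ 2 * (3 * r - 1)) - 8 * ((r ^ 2 + r + 1) * p * (2 * a - r - p)) := by
    unfold excess; ring
  rw [e]
  obtain ⟨h, hh⟩ : ∃ h, h = r * (r + 2) / 3 := ⟨_, rfl⟩
  have hh' : r * (r + 2) = 3 * h := by rw [hh]; ring
  rw [hh'] at hpoly ⊢
  rw [← hh] at hE
  have hh0 : 0 < h := by rw [hh]; positivity
  rcases le_total a h with hah | hah
  -- A convex quadratic in a on the interval [r, h]: the two endpoints suffice, and the endpoint h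
  -- is `hpoly`.
  · have h1 : 8 * a * (2 * a - 3 * h) + (r + 1) ^ 2 * (3 * r - 1) ≤ 0 := by
      have h2 : 8 * r * (2 * r - 3 * h) + (r + 1) ^ 2 * (3 * r - 1) ≤ 0 := by
        rw [← hh']
        nlinarith [mul_nonneg (by linarith : 0 ≤ r - 2) (by positivity : 0 ≤ r ^ 2),
          mul_nonneg (by linarith : 0 ≤ r - 2) (by linarith : 0 ≤ r)]
      have h3 : 8 * h * (2 * h - 3 * h) + (r + 1) ^ 2 * (3 * r - 1) ≤ 0 := by nlinarith
      have h4 := mul_nonneg (by linarith : 0 ≤ a - r) (by linarith : 0 ≤ h - a)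
      rcases le_total 0 (16 * (r + h) - 24 * h) with h5 | h5
      · nlinarith [mul_nonneg h5 (by linarith : 0 ≤ h - a)]
      · nlinarith [mul_nonneg_of_nonpos_of_nonpos h5 (by linarith : r - a ≤ 0)]
    have h2 : 0 ≤ (r ^ 2 + r + 1) * p * (2 * a - r - p) :=
      mul_nonneg (by positivity) (by linarith)
    have h3 := mul_nonneg (by linarith : 0 ≤ 1 + r) (neg_nonneg.2 h1)
    linarith
  · obtain ⟨q, hq⟩ : ∃ q, q = (1 + r) * (a - h) / (r ^ 2 + r + 1) := ⟨_, rfl⟩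
    have hqK : (r ^ 2 + r + 1) * q = (1 + r) * (a - h) := by
      rw [hq]; field_simp
    have hah' : 0 ≤ a - h := by linarith
    have hq0 : 0 ≤ q := by rw [hq]; positivity
    have hqp : q ≤ p := by
      rw [hq, div_le_iff₀ hK]; linarith
    -- The constant 3/7 is the value of (1 + r) / (r² + r + 1) at r = 2, its maximum for r ≥ 2.
    have hq37 : q ≤ 3 / 7 * (a - h) := by
      rw [hq, div_le_iff₀ hK]
      nlinarith [mul_nonneg hah' (mul_nonneg (by linarith : 0 ≤ r - 2)
        (by linarith : 0 ≤ 3 * r + 2))]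
    have h1 : (r ^ 2 + r + 1) * q * (2 * a - r - q) ≤ (r ^ 2 + r + 1) * p * (2 * a - r - p) := by
      have := mul_nonneg hK.le (mul_nonneg (by linarith : 0 ≤ p - q)
        (by linarith : 0 ≤ 2 * a - r - p - q))
      linarith
    have h2 : 8 * a * (2 * a - 3 * h) + (r + 1) ^ 2 * (3 * r - 1) ≤
        12 * (a - h) * (2 * a - r - q) := by
      obtain ⟨d, hd⟩ : ∃ d, d = a - h := ⟨_, rfl⟩
      have ha : a = d + h := by rw [hd]; ring
      rw [← hd] at hq37 hah' ⊢
      rw [ha]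
      have h3 := mul_nonneg hah' (by linarith : 0 ≤ 3 / 7 * d - q)
      have h4 : 12 * r ≤ 16 * h := by nlinarith
      have h5 := mul_nonneg hah' (by linarith : 0 ≤ 16 * h - 12 * r)
      nlinarith [sq_nonneg d]
    rw [hqK] at h1
    have h3 := mul_le_mul_of_nonneg_left h2 (by linarith : 0 ≤ 2 / 3 * (1 + r))
    linarith

theorem excess_eq (a b r p : ℝ) :
    excess a b r p = 8 * a * (b - 2) *
      ((1 + r) * (a - r * (r + 2) / 3) - p * (r ^ 2 + r + 1)) + excess a 2 r p := by
  unfold excess; ring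

theorem pos_of_excess_pos {a b r p : ℝ} (hb : 2 ≤ b) (hr : 2 ≤ r) (hp : 0 ≤ p) (hrp : r + p ≤ a)
    (h : 0 < excess a b r p) :
    0 < (1 + r) * (a - r * (r + 2) / 3) - p * (r ^ 2 + r + 1) := by
  by_contra! hE
  have h1 := path_excess_nonpos hr hp hrp hE
  have h2 : 0 ≤ 8 * a * (b - 2) := mul_nonneg (by linarith) (by linarith)
  rw [excess_eq] at h
  have := mul_nonpos_of_nonneg_of_nonpos h2 hE
  linarith

theorem excess_pos_of_path_excess_pos {a b r p : ℝ} (hb : 2 ≤ b) (hr : 2 ≤ r) (hp : 0 ≤ p)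
    (hrp : r + p ≤ a) (h : 0 < excess a 2 r p) : 0 < excess a b r p := by
  have h1 := pos_of_excess_pos le_rfl hr hp hrp h
  rw [excess_eq]
  have h2 : 0 ≤ 8 * a * (b - 2) := mul_nonneg (by linarith) (by linarith)
  positivity

/-- The first hypothesis makes the main term at least 16/3 · (1+r)a², and the second keeps the loss
due to p within that amount; the cubic term in r + 1 gives strictness. -/
theorem path_excess_pos {a r p : ℝ} (hr : 2 ≤ r) (hp : 0 ≤ p) (hra : r * (r + 2) ≤ a)
    (hpa : 3 * (r + 1) * p ≤ a) : 0 < excess a 2 r p := by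
  have ha : 0 < a := by nlinarith
  have h1 : (1 + r) * a * a ≤ (1 + r) * a * (2 * a - r * (r + 2)) :=
    mul_le_mul_of_nonneg_left (by linarith) (by positivity)
  have h2 : (r ^ 2 + r + 1) * p * (2 * a - r - p) ≤ (r + 1) ^ 2 * p * (2 * a) := by
    have h3 : (r ^ 2 + r + 1) * p ≤ (r + 1) ^ 2 * p :=
      mul_le_mul_of_nonneg_right (by nlinarith) hp
    calc (r ^ 2 + r + 1) * p * (2 * a - r - p) ≤ (r ^ 2 + r + 1) * p * (2 * a) :=
          mul_le_mul_of_nonneg_left (by linarith) (by positivity)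
      _ ≤ _ := mul_le_mul_of_nonneg_right h3 (by positivity)
  have h3 := mul_le_mul_of_nonneg_left hpa (by positivity : 0 ≤ (r + 1) * a)
  have h4 : 0 < (r + 1) ^ 3 * (3 * r - 1) := mul_pos (by positivity) (by linarith)
  unfold excess
  nlinarith

end Excess

/-! ### Counting Braess edges by pairs (r, p). -/

section Count

open Classical in
/-- The pairs `(r, p)` such that joining the vertices at distances `p` and `p + r` from the end of
a leg gives a Braess edge. -/
noncomputable def braessPairs (a b : ℕ) : Finset (ℕ × ℕ) :=
  (Finset.range (a + 1) ×ˢ Finset.range (a + 1)).filter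
    fun q => 2 ≤ q.1 ∧ q.1 + q.2 ≤ a ∧ 0 < excess a b q.1 q.2

theorem mem_braessPairs {a b r p : ℕ} :
    (r, p) ∈ braessPairs a b ↔ 2 ≤ r ∧ r + p ≤ a ∧ 0 < excess a b r p := by
  classical
  unfold braessPairs
  rw [Finset.mem_filter, Finset.mem_product, Finset.mem_range, Finset.mem_range]
  refine and_iff_right_of_imp fun h => ?_
  have := h.2.1
  constructor <;> simp only <;> omega

theorem spider_adj_vtx {a b : ℕ} (i : Fin b) {k : ℕ} (hk : k < a) :
    (spider a b).Adj (vtx i k) (vtx i (k + 1)) := by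
  rw [vtx_succ i hk]
  rcases k with _ | k
  · rw [vtx_zero, spider_adj_none_some]
  · rw [vtx_succ i (by omega), spider_adj_some_some]
    exact ⟨rfl, Or.inl rfl⟩

theorem exists_same_leg {a b : ℕ} (ha : 2 ≤ a) (hb : 2 ≤ b)
    {e : Sym2 (Option (Fin b × Fin a))} (he : IsBraessEdge (spider a b) e) :
    ∃ i : Fin b, ∃ k l : ℕ, k < l ∧ l ≤ a ∧ e = s(vtx i k, vtx i l) := by
  have h1 : ∃ i : Fin b, ∃ k ≤ a, ∃ l ≤ a, e = s(vtx i k, vtx i l) := by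
    induction e with | _ u v
    obtain ⟨i, k, hk, rfl⟩ := exists_vtx (by omega) u
    obtain ⟨j, l, hl, rfl⟩ := exists_vtx (by omega) v
    by_cases hij : i = j
    · exact ⟨i, k, hk, l, hl, by rw [hij]⟩
    · rcases Nat.eq_zero_or_pos k with rfl | hk0
      · exact ⟨j, 0, hk, l, hl, rfl⟩
      · rcases Nat.eq_zero_or_pos l with rfl | hl0
        · exact ⟨i, k, hk, 0, hl, rfl⟩
        · exact absurd he (not_isBraessEdge_different_legs k l ha hb hij hk0 hl0 hk hl)
  obtain ⟨i, k, hk, l, hl, rfl⟩ := h1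
  rcases lt_trichotomy k l with h | rfl | h
  · exact ⟨i, k, l, h, hl, rfl⟩
  · exact (he.1 (by simp)).elim
  · exact ⟨i, l, k, h, hk, Sym2.eq_swap⟩

theorem numBraess_spider {a b : ℕ} (ha : 2 ≤ a) (hb : 2 ≤ b) :
    numBraess (spider a b) = b * (braessPairs a b).card := by
  classical
  have hcard : b * (braessPairs a b).card =
      ((Finset.univ : Finset (Fin b)) ×ˢ braessPairs a b).card := by
    rw [Finset.card_product, Finset.card_univ, Fintype.card_fin]
  let f : Fin b × (ℕ × ℕ) → Sym2 (Option (Fin b × Fin a)) := fun q =>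
    s(vtx q.1 (a - q.2.2 - q.2.1), vtx q.1 (a - q.2.2))
  have hset : {e | IsBraessEdge (spider a b) e} =
      f '' ((Finset.univ : Finset (Fin b)) ×ˢ braessPairs a b : Finset _) := by
    ext e
    simp only [Set.mem_ofPred_eq, Set.mem_image, Finset.mem_coe, Finset.mem_product,
      Finset.mem_univ, true_and, Prod.exists, mem_braessPairs]
    constructor
    · intro he
      obtain ⟨i, k, l, hkl, hl, rfl⟩ := exists_same_leg ha hb he
      obtain ⟨r, rfl⟩ := Nat.exists_eq_add_of_lt hkl
      have hr : 2 ≤ r + 1 := by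
        by_contra! h
        obtain rfl : r = 0 := by omega
        exact he.2.1 (spider_adj_vtx i (by omega))
      refine ⟨i, r + 1, a - (k + r + 1), ⟨hr, by omega, ?_⟩, ?_⟩
      · exact (isBraessEdge_same_leg i k (r + 1) (a - (k + r + 1)) (by omega) hr
          (by omega)).1 he
      · simp only [f]
        congr 3 <;> omega
    · rintro ⟨i, r, p, ⟨hr, hrp, hex⟩, rfl⟩
      have h1 := (isBraessEdge_same_leg i (a - p - r) r p (by omega) hr (by omega)).2 hex
      rwa [show a - p - r + r = a - p by omega] at h1
  unfold numBraess
  rw [hset, hcard, Set.InjOn.ncard_image, Set.ncard_coe_finset]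
  rintro ⟨i, r, p⟩ h1 ⟨j, r', p'⟩ h2 h
  simp only [Finset.mem_coe, Finset.mem_product, Finset.mem_univ, true_and,
    mem_braessPairs] at h1 h2
  obtain ⟨hr, hrp, -⟩ := h1
  obtain ⟨hr', hrp', -⟩ := h2
  simp only [f, Sym2.eq_iff] at h
  rw [vtx_eq_vtx (by omega) (by omega), vtx_eq_vtx (by omega) (by omega),
    vtx_eq_vtx (by omega) (by omega), vtx_eq_vtx (by omega) (by omega)] at h
  simp only [Prod.mk.injEq]
  -- The outer vertex has depth at least r ≥ 2, so it is not the center and determines the leg; the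
  -- swapped matching contradicts the order of depths.
  rcases h with ⟨⟨h3, -⟩, h4, h5 | h5⟩ | ⟨⟨h3, -⟩, h4, -⟩
  · omega
  · exact ⟨h5, by omega, by omega⟩
  · omega

theorem braessPairs_subset {a b : ℕ} (hb : 2 ≤ b) : braessPairs a 2 ⊆ braessPairs a b := by
  rintro ⟨r, p⟩ h
  rw [mem_braessPairs] at h ⊢
  obtain ⟨hr, hrp, hex⟩ := h
  refine ⟨hr, hrp, excess_pos_of_path_excess_pos (by exact_mod_cast hb) (by exact_mod_cast hr)
    (by positivity) (by exact_mod_cast hrp) (by exact_mod_cast hex)⟩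

end Count

/-! ### The path as the spider with two legs. -/

section Path

/-- The position on the path of a vertex of the spider with two legs. -/
def pathPosition (a : ℕ) : Option (Fin 2 × Fin a) → Fin (2 * a + 1)
  | none => ⟨a, by omega⟩
  | some (0, k) => ⟨a - 1 - k, by omega⟩
  | some (1, k) => ⟨a + 1 + k, by omega⟩

theorem pathPosition_injective (a : ℕ) : Function.Injective (pathPosition a) := by
  rintro (_ | ⟨i, k⟩) (_ | ⟨j, l⟩) h
  · rfl
  · exfalso
    fin_cases j <;> simp [pathPosition, Fin.ext_iff] at h <;> omega
  · exfalso
    fin_cases i <;> simp [pathPosition, Fin.ext_iff] at h <;> omega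
  · fin_cases i <;> fin_cases j <;> simp [pathPosition, Fin.ext_iff] at h ⊢ <;> omega

theorem pathPosition_adj (a : ℕ) (x y : Option (Fin 2 × Fin a)) :
    (SimpleGraph.pathGraph (2 * a + 1)).Adj (pathPosition a x) (pathPosition a y) ↔
      (spider a 2).Adj x y := by
  rw [SimpleGraph.pathGraph_adj]
  rcases x with _ | ⟨i, k⟩ <;> rcases y with _ | ⟨j, l⟩
  · simp
  · rw [spider_adj_none_some]
    fin_cases j <;> simp [pathPosition] <;> omega
  · rw [SimpleGraph.adj_comm, spider_adj_none_some]
    fin_cases i <;> simp [pathPosition] <;> omega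
  · rw [spider_adj_some_some]
    fin_cases i <;> fin_cases j <;> simp [pathPosition] <;> omega

/-- The spider with two legs is a path. -/
noncomputable def spiderIsoPath (a : ℕ) : spider a 2 ≃g SimpleGraph.pathGraph (2 * a + 1) where
  toEquiv := Equiv.ofBijective (pathPosition a)
    ((Fintype.bijective_iff_injective_and_card _).2 ⟨pathPosition_injective a, by simp⟩)
  map_rel_iff' := pathPosition_adj a _ _

theorem numBraess_pathGraph {a : ℕ} (ha : 0 < a) :
    numBraess (SimpleGraph.pathGraph (2 * a + 1)) = numBraess (spider a 2) :=
  numBraess_iso (isResistance_spiderDist ha two_pos) spiderDist_nonneg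
    (wdeg_spider_pos ha two_pos) (spiderIsoPath a).symm

theorem path_le_spider {a b : ℕ} (ha : 2 ≤ a) (hb : 2 ≤ b) :
    (b : ℝ) / 2 * (numBraess (SimpleGraph.pathGraph (2 * a + 1)) : ℝ) ≤
      (numBraess (spider a b) : ℝ) := by
  rw [numBraess_pathGraph (by omega), numBraess_spider ha le_rfl, numBraess_spider ha hb]
  have h : ((braessPairs a 2).card : ℝ) ≤ (braessPairs a b).card := by
    exact_mod_cast Finset.card_le_card (braessPairs_subset hb)
  push_cast
  calc (b : ℝ) / 2 * (2 * (braessPairs a 2).card) = b * (braessPairs a 2).card := by ring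
    _ ≤ _ := mul_le_mul_of_nonneg_left h (by positivity)

end Path

/-! ### The series T₁^∞ and the harmonic sum. -/

section Series

theorem tTerm_eq {l : ℕ} (hl : 1 ≤ l) :
    tTerm l = ((l : ℝ) - 1) / (l * ((l : ℝ) ^ 2 - l + 1)) := by
  have h1 : (1 : ℝ) ≤ l := by exact_mod_cast hl
  have h2 : (l : ℝ) ^ 2 - l + 1 ≠ 0 := by nlinarith
  have h3 : (l : ℝ) ≠ 0 := by positivity
  unfold tTerm
  rw [div_sub_div _ _ h2 h3, div_eq_div_iff (mul_ne_zero h2 h3) (mul_ne_zero h3 h2)]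
  ring

theorem tTerm_nonneg {l : ℕ} (hl : 1 ≤ l) : 0 ≤ tTerm l := by
  have h1 : (1 : ℝ) ≤ l := by exact_mod_cast hl
  rw [tTerm_eq hl]
  have h2 : 0 ≤ (l : ℝ) ^ 2 - l + 1 := by nlinarith
  exact div_nonneg (by linarith) (by positivity)

theorem tTerm_le {l : ℕ} (hl : 1 ≤ l) : tTerm l ≤ 1 / (l : ℝ) ^ 2 := by
  have h1 : (1 : ℝ) ≤ l := by exact_mod_cast hl
  rw [tTerm_eq hl]
  have h2 : 0 < (l : ℝ) ^ 2 - l + 1 := by nlinarith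
  rw [div_le_div_iff₀ (by positivity) (by positivity)]
  nlinarith

theorem summable_tTerm : Summable fun n : ℕ => tTerm (n + 3) := by
  have h : Summable fun n : ℕ => 1 / ((n + 3 : ℕ) : ℝ) ^ 2 :=
    (summable_nat_add_iff 3).2 (Real.summable_one_div_nat_pow.2 one_lt_two)
  exact Summable.of_nonneg_of_le (fun n => tTerm_nonneg (by omega)) (fun n => tTerm_le (by omega)) h

theorem summable_abs_tTerm : Summable fun n : ℕ => |tTerm (n + 3)| :=
  summable_tTerm.abs

theorem sum_tTerm_le (M : ℕ) : ∑ n ∈ Finset.range M, tTerm (n + 3) ≤ tInfty :=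
  summable_tTerm.sum_le_tsum _ fun n _ => tTerm_nonneg (by omega)

theorem sum_one_div_add_three (M : ℕ) :
    ∑ n ∈ Finset.range M, 1 / ((n : ℝ) + 3) = (harmonic (M + 2) : ℝ) - 3 / 2 := by
  induction M with
  | zero => norm_num [harmonic_succ]
  | succ M ih =>
    rw [Finset.sum_range_succ, ih, show M + 1 + 2 = (M + 2) + 1 by ring, harmonic_succ (M + 2)]
    push_cast
    ring

end Series

/-! ### The upper bound. -/

section UpperBound

theorem card_braessPairs_le_sum {a b : ℕ} (hb : 2 ≤ b) :
    ((braessPairs a b).card : ℝ) ≤ ∑ n ∈ Finset.range (Nat.sqrt (3 * a + 1) - 2),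
      (a * (tTerm (n + 3) + 1 / ((n : ℝ) + 3)) - ((n : ℝ) + 3) / 3 + 1) := by
  classical
  set M := Nat.sqrt (3 * a + 1) - 2 with hM
  -- The bound on p obtained by solving `pos_of_excess_pos` for p, with r = n + 2 and l = n + 3.
  let w : ℕ → ℝ := fun n =>
    ((n : ℝ) + 3) * (a - ((n : ℝ) + 2) * (n + 4) / 3) / (((n : ℝ) + 2) ^ 2 + (n + 2) + 1)
  have hcard : (braessPairs a b).card ≤
      ((Finset.range M).sigma fun n => Finset.range ⌈w n⌉₊).card := by
    refine Finset.card_le_card_of_injOn (fun q => ⟨q.1 - 2, q.2⟩) ?_ ?_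
    · rintro ⟨r, p⟩ h
      rw [Finset.mem_coe, mem_braessPairs] at h
      obtain ⟨hr, hrp, hex⟩ := h
      obtain ⟨n, rfl⟩ := Nat.exists_eq_add_of_le' hr
      have hE := pos_of_excess_pos (by exact_mod_cast hb) (by exact_mod_cast hr) (by positivity)
        (by exact_mod_cast hrp) hex
      push_cast at hE
      have hK : (0 : ℝ) < ((n : ℝ) + 2) ^ 2 + (n + 2) + 1 := by positivity
      have hpw : (p : ℝ) < w n := by
        simp only [w]
        rw [lt_div_iff₀ hK]
        linarith
      have h1 : 0 < (1 + ((n : ℝ) + 2)) * (a - (n + 2) * (n + 2 + 2) / 3) := by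
        have : 0 ≤ (p : ℝ) * (((n : ℝ) + 2) ^ 2 + (n + 2) + 1) := by positivity
        linarith
      have h2 : 0 < (a : ℝ) - (n + 2) * (n + 2 + 2) / 3 :=
        pos_of_mul_pos_right h1 (by positivity)
      have h3 : (n + 2) * (n + 2 + 2) < 3 * a := by
        have : ((n : ℝ) + 2) * (n + 2 + 2) < 3 * a := by linarith
        exact_mod_cast this
      have h4 : n + 3 ≤ Nat.sqrt (3 * a + 1) := by
        rw [Nat.le_sqrt]
        nlinarith
      simp only [Finset.coe_sigma, Set.mem_sigma_iff, Finset.mem_coe, Finset.mem_range,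
        Nat.add_sub_cancel]
      exact ⟨by omega, Nat.lt_ceil.2 hpw⟩
    · rintro ⟨r, p⟩ h ⟨r', p'⟩ h' he
      rw [Finset.mem_coe, mem_braessPairs] at h h'
      simp only [Sigma.mk.injEq, heq_eq_eq] at he
      simp only [Prod.mk.injEq]
      omega
  rw [Finset.card_sigma] at hcard
  simp only [Finset.card_range] at hcard
  have hcard' : ((braessPairs a b).card : ℝ) ≤ ∑ n ∈ Finset.range M, (⌈w n⌉₊ : ℝ) := by
    exact_mod_cast hcard
  refine hcard'.trans (Finset.sum_le_sum fun n hn => ?_)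
  have hn' : n + 3 ≤ Nat.sqrt (3 * a + 1) := by
    have := Finset.mem_range.1 hn
    omega
  rw [Nat.le_sqrt] at hn'
  have h1 : ((n : ℝ) + 2) * (n + 4) / 3 ≤ a := by
    have : ((n : ℝ) + 3) * (n + 3) ≤ 3 * a + 1 := by exact_mod_cast hn'
    linarith
  have hK : (0 : ℝ) < ((n : ℝ) + 2) ^ 2 + (n + 2) + 1 := by positivity
  have hw0 : 0 ≤ w n := div_nonneg (mul_nonneg (by positivity) (by linarith)) hK.le
  have h2 : w n ≤ a * (tTerm (n + 3) + 1 / ((n : ℝ) + 3)) - ((n : ℝ) + 3) / 3 := by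
    have e : w n = a * (tTerm (n + 3) + 1 / ((n : ℝ) + 3)) -
        ((n : ℝ) + 3) / 3 * (((n : ℝ) + 2) * (n + 4) / (((n : ℝ) + 2) ^ 2 + (n + 2) + 1)) := by
      have e2 : tTerm (n + 3) + 1 / ((n : ℝ) + 3) =
          ((n : ℝ) + 3) / (((n : ℝ) + 2) ^ 2 + (n + 2) + 1) := by
        unfold tTerm
        push_cast
        rw [sub_add_cancel]
        congr 1
        ring
      rw [e2]
      simp only [w]
      field_simp
    rw [e]
    -- This is r(r+2) ≥ r²+r+1, which lets the subtracted term be replaced by l/3.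
    have h3 : 1 ≤ ((n : ℝ) + 2) * (n + 4) / (((n : ℝ) + 2) ^ 2 + (n + 2) + 1) := by
      rw [le_div_iff₀ hK]
      nlinarith [Nat.cast_nonneg (α := ℝ) n]
    have h4 := mul_le_mul_of_nonneg_left h3 (by positivity : 0 ≤ ((n : ℝ) + 3) / 3)
    linarith
  have := Nat.ceil_lt_add_one hw0
  linarith

theorem sum_add_three_div_three (M : ℕ) :
    ∑ n ∈ Finset.range M, (((n : ℝ) + 3) / 3 - 1) = (M : ℝ) * (M - 1) / 6 := by
  induction M with
  | zero => simp
  | succ M ih =>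
    rw [Finset.sum_range_succ, ih]
    push_cast
    ring

theorem card_braessPairs_le {a b : ℕ} (ha : 2 ≤ a) (hb : 2 ≤ b) :
    ((braessPairs a b).card : ℝ) ≤
      (1 / 2 * Real.log (3 * (a : ℝ) + 1) + tInfty + Real.eulerMascheroniConstant - 2) * a +
        2 * Real.sqrt (3 * a + 1) := by
  refine (card_braessPairs_le_sum hb).trans ?_
  obtain ⟨L, hL⟩ : ∃ L, L = Nat.sqrt (3 * a + 1) := ⟨_, rfl⟩
  rw [← hL]
  have hL2 : 2 ≤ L := by
    rw [hL, Nat.le_sqrt]; omega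
  obtain ⟨M, rfl⟩ := Nat.exists_eq_add_of_le' hL2
  rw [Nat.add_sub_cancel]
  have e : ∑ n ∈ Finset.range M,
      ((a : ℝ) * (tTerm (n + 3) + 1 / ((n : ℝ) + 3)) - ((n : ℝ) + 3) / 3 + 1) =
      a * (∑ n ∈ Finset.range M, tTerm (n + 3)) +
        a * ((harmonic (M + 2) : ℝ) - 3 / 2) - (M : ℝ) * (M - 1) / 6 := by
    rw [← sum_one_div_add_three, ← sum_add_three_div_three, Finset.mul_sum, Finset.mul_sum,
      ← Finset.sum_add_distrib, ← Finset.sum_sub_distrib]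
    exact Finset.sum_congr rfl fun n _ => by ring
  rw [e]
  obtain ⟨R, hR⟩ : ∃ R, R = Real.sqrt (3 * a + 1) := ⟨_, rfl⟩
  have hRsq : R ^ 2 = 3 * a + 1 := by rw [hR, Real.sq_sqrt (by positivity)]
  have ha' : (2 : ℝ) ≤ a := by exact_mod_cast ha
  have hR2 : 2 ≤ R := by
    rw [hR]; exact Real.le_sqrt_of_sq_le (by linarith)
  have hLR : ((M + 2 : ℕ) : ℝ) ≤ R := by
    rw [hR]
    refine Real.le_sqrt_of_sq_le ?_
    have : (M + 2) ^ 2 ≤ 3 * a + 1 := by rw [hL]; exact Nat.sqrt_le' _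
    exact_mod_cast this
  have hRL : R < ((M + 2 : ℕ) : ℝ) + 1 := by
    rw [hR, Real.sqrt_lt' (by positivity)]
    have : 3 * a + 1 < (M + 2 + 1) ^ 2 := by rw [hL]; exact Nat.lt_succ_sqrt' _
    exact_mod_cast this
  -- H_L - log(L+1) increases to γ, and L + 1 ≤ R + 1 costs only log(1 + 1/R) ≤ 1/R beyond log R.
  have hharm : (harmonic (M + 2) : ℝ) ≤
      Real.eulerMascheroniConstant + 1 / 2 * Real.log (3 * a + 1) + 1 / R := by
    have h1 := Real.eulerMascheroniSeq_lt_eulerMascheroniConstant (M + 2)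
    unfold Real.eulerMascheroniSeq at h1
    have h2 : Real.log (((M + 2 : ℕ) : ℝ) + 1) ≤ Real.log (R * (1 + 1 / R)) := by
      refine Real.log_le_log (by positivity) ?_
      have : R * (1 + 1 / R) = R + 1 := by field_simp
      linarith
    rw [Real.log_mul (by positivity) (by positivity)] at h2
    have h3 : Real.log (1 + 1 / R) ≤ 1 / R := by
      have := Real.log_le_sub_one_of_pos (by positivity : 0 < 1 + 1 / R)
      linarith
    have h4 : Real.log R = 1 / 2 * Real.log (3 * a + 1) := by
      rw [hR, Real.log_sqrt (by positivity)]; ring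
    linarith
  rw [← hR]
  have h1 := mul_le_mul_of_nonneg_left (sum_tTerm_le M) (by positivity : (0 : ℝ) ≤ a)
  have h2 := mul_le_mul_of_nonneg_left hharm (by positivity : (0 : ℝ) ≤ a)
  have h3 : (a : ℝ) * (1 / R) ≤ R / 3 := by
    rw [mul_one_div, div_le_iff₀ (by positivity)]
    linarith
  push_cast at hRL hLR
  -- Since R² = 3a + 1, this makes M(M-1)/6 at least a/2 - 3R/2; with the R/3 from `h3` the total
  -- error stays below 2R.
  have h4 : (R - 3) * (R - 4) ≤ (M : ℝ) * (M - 1) + 2 * R := by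
    nlinarith [mul_nonneg (by linarith : 0 ≤ (M : ℝ) - R + 3)
      (by linarith [Nat.cast_nonneg (α := ℝ) M] : 0 ≤ (M : ℝ) + R - 2)]
  linarith

theorem sqrt_isLittleO :
    (fun a : ℕ => 2 * Real.sqrt (3 * (a : ℝ) + 1)) =o[atTop] (fun a : ℕ => (a : ℝ)) := by
  refine isLittleO_iff.2 fun c hc => ?_
  filter_upwards [eventually_ge_atTop ⌈16 / c ^ 2⌉₊, eventually_ge_atTop 1] with a ha ha1
  have h1 : 16 / c ^ 2 ≤ (a : ℝ) := (Nat.le_ceil _).trans (by exact_mod_cast ha)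
  have h2 : (1 : ℝ) ≤ a := by exact_mod_cast ha1
  rw [div_le_iff₀ (by positivity)] at h1
  have h3 : Real.sqrt (3 * (a : ℝ) + 1) ≤ c * a / 2 := by
    rw [Real.sqrt_le_left (by positivity)]
    nlinarith [mul_le_mul_of_nonneg_left h1 (by positivity : (0 : ℝ) ≤ a)]
  rw [Real.norm_of_nonneg (by positivity), Real.norm_of_nonneg (by positivity)]
  linarith

end UpperBound

/-! ### The order of growth a ln a. -/

section Order

theorem card_braessPairs_ge {a : ℕ} (ha : 2 ≤ a) :
    (a : ℝ) / 3 * (1 / 2 * Real.log a - 3 / 2) ≤ ((braessPairs a 2).card : ℝ) := by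
  classical
  -- The maximum with 2 serves small a: then M = 0 and the sum is empty.
  obtain ⟨L, hL⟩ : ∃ L, L = max 2 (Nat.sqrt (a + 1)) := ⟨_, rfl⟩
  obtain ⟨M, hM⟩ := Nat.exists_eq_add_of_le' (hL ▸ le_max_left _ _ : 2 ≤ L)
  let w : ℕ → ℝ := fun n => (a : ℝ) / (3 * ((n : ℝ) + 3))
  have hcard : ((Finset.range M).sigma fun n => Finset.range (⌊w n⌋₊ + 1)).card ≤
      (braessPairs a 2).card := by
    refine Finset.card_le_card_of_injOn (fun q => (q.1 + 2, q.2)) ?_ ?_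
    · rintro ⟨n, p⟩ h
      simp only [Finset.coe_sigma, Set.mem_sigma_iff, Finset.mem_coe, Finset.mem_range] at h
      obtain ⟨hn, hp⟩ := h
      have hn' : n + 3 ≤ Nat.sqrt (a + 1) := by omega
      rw [Nat.le_sqrt] at hn'
      have hp' : (p : ℝ) ≤ w n := (Nat.le_floor_iff (by positivity)).1 (Nat.lt_succ_iff.1 hp)
      simp only [w] at hp'
      rw [le_div_iff₀ (by positivity)] at hp'
      have hp'' : p * (3 * (n + 3)) ≤ a := by exact_mod_cast hp'
      rw [Finset.mem_coe, mem_braessPairs]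
      refine ⟨by omega, by nlinarith, path_excess_pos ?_ (by positivity) ?_ ?_⟩
      · push_cast; linarith [Nat.cast_nonneg (α := ℝ) n]
      · have : (n + 2) * (n + 2 + 2) ≤ a := by nlinarith
        exact_mod_cast this
      · push_cast; linarith
    · rintro ⟨n, p⟩ - ⟨n', p'⟩ - he
      simp only [Prod.mk.injEq] at he
      obtain ⟨h1, rfl⟩ := he
      obtain rfl : n = n' := by omega
      rfl
  rw [Finset.card_sigma] at hcard
  simp only [Finset.card_range] at hcard
  have hcard' : ∑ n ∈ Finset.range M, ((⌊w n⌋₊ : ℝ) + 1) ≤ ((braessPairs a 2).card : ℝ) := by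
    exact_mod_cast hcard
  refine le_trans ?_ hcard'
  have h1 : ∑ n ∈ Finset.range M, w n ≤ ∑ n ∈ Finset.range M, ((⌊w n⌋₊ : ℝ) + 1) :=
    Finset.sum_le_sum fun n _ => (Nat.lt_floor_add_one (w n)).le
  refine le_trans ?_ h1
  have h2 : ∑ n ∈ Finset.range M, w n = (a : ℝ) / 3 * ((harmonic (M + 2) : ℝ) - 3 / 2) := by
    rw [← sum_one_div_add_three, Finset.mul_sum]
    refine Finset.sum_congr rfl fun n _ => ?_
    simp only [w]
    field_simp
  rw [h2, ← hM]
  have h3 := log_add_one_le_harmonic L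
  have h4 : 1 / 2 * Real.log a ≤ Real.log ((L + 1 : ℕ) : ℝ) := by
    have h5 : Real.log a ≤ Real.log (((L + 1 : ℕ) : ℝ) ^ 2) := by
      refine Real.log_le_log (by positivity) ?_
      have h6 : a + 1 < (Nat.sqrt (a + 1) + 1) ^ 2 := Nat.lt_succ_sqrt' _
      have h7 : (Nat.sqrt (a + 1) + 1) ^ 2 ≤ (L + 1) ^ 2 :=
        Nat.pow_le_pow_left (by omega) 2
      have : a ≤ (L + 1) ^ 2 := by omega
      exact_mod_cast this
    rw [Real.log_pow, Nat.cast_ofNat] at h5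
    linarith
  exact mul_le_mul_of_nonneg_left (by linarith) (by positivity)

/-- From ln a ≥ 6 on, 3/2 is at most a quarter of ln a, which leaves 1/3 · 1/4 = 1/12. -/
theorem card_braessPairs_ge_log {a : ℕ} (ha : 2 ≤ a) (hlog : 6 ≤ Real.log a) :
    1 / 12 * ((a : ℝ) * Real.log a) ≤ ((braessPairs a 2).card : ℝ) := by
  refine le_trans ?_ (card_braessPairs_ge ha)
  have := mul_le_mul_of_nonneg_left hlog (by positivity : (0 : ℝ) ≤ a)
  linarith

/-- The logarithm contributes 3/2 and the square root term 4, together below 6. -/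
theorem card_braessPairs_le_log {a b : ℕ} (ha : 2 ≤ a) (hb : 2 ≤ b) (hlog : 1 ≤ Real.log a) :
    ((braessPairs a b).card : ℝ) ≤
      (6 + |tInfty + Real.eulerMascheroniConstant - 2|) * ((a : ℝ) * Real.log a) := by
  refine (card_braessPairs_le ha hb).trans ?_
  have ha' : (2 : ℝ) ≤ a := by exact_mod_cast ha
  have h1 : Real.log (3 * (a : ℝ) + 1) ≤ 3 * Real.log a := by
    have : Real.log (3 * (a : ℝ) + 1) ≤ Real.log ((a : ℝ) ^ 3) :=
      Real.log_le_log (by positivity) (by nlinarith [sq_nonneg ((a : ℝ) - 2)])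
    rwa [Real.log_pow] at this
  have h2 : Real.sqrt (3 * (a : ℝ) + 1) ≤ 2 * a := by
    rw [Real.sqrt_le_left (by positivity)]
    nlinarith
  have h3 := le_abs_self (tInfty + Real.eulerMascheroniConstant - 2)
  have h4 := abs_nonneg (tInfty + Real.eulerMascheroniConstant - 2)
  set Q := |tInfty + Real.eulerMascheroniConstant - 2|
  have h5 := mul_le_mul_of_nonneg_left hlog (by positivity : 0 ≤ (Q + 4) * (a : ℝ))
  have h6 := mul_le_mul_of_nonneg_right h1 (by positivity : (0 : ℝ) ≤ a)
  have h7 := mul_le_mul_of_nonneg_right h3 (by positivity : (0 : ℝ) ≤ a)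
  nlinarith

end Order

end Braess

theorem theorem4p7 :
    (Summable fun n : ℕ => |Braess.tTerm (n + 3)|) ∧
    (∀ a b : ℕ, 2 ≤ a → 2 ≤ b →
      (b : ℝ) / 2 * (Braess.numBraess (SimpleGraph.pathGraph (2 * a + 1)) : ℝ)
        ≤ (Braess.numBraess (Braess.spider a b) : ℝ)) ∧
    (∃ ε : ℕ → ℝ, ε =o[atTop] (fun a : ℕ => (a : ℝ)) ∧
      ∀ a b : ℕ, 2 ≤ a → 2 ≤ b →
        (Braess.numBraess (Braess.spider a b) : ℝ)
          ≤ (1 / 2 * Real.log (3 * (a : ℝ) + 1) + Braess.tInfty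
              + Real.eulerMascheroniConstant - 2) * ((a : ℝ) * (b : ℝ)) + ε a * (b : ℝ)) ∧
    (∃ c C : ℝ, 0 < c ∧ 0 < C ∧ ∃ A : ℕ, ∀ a b : ℕ, A ≤ a → 2 ≤ b →
      c * ((a : ℝ) * (b : ℝ) * Real.log (a : ℝ)) ≤ (Braess.numBraess (Braess.spider a b) : ℝ) ∧
      (Braess.numBraess (Braess.spider a b) : ℝ) ≤ C * ((a : ℝ) * (b : ℝ) * Real.log (a : ℝ))) := by
  -- The error function is 2√(3a+1), and the threshold e⁶ ensures ln a ≥ 6.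
  refine ⟨Braess.summable_abs_tTerm, fun a b ha hb => Braess.path_le_spider ha hb,
    ⟨_, Braess.sqrt_isLittleO, fun a b ha hb => ?_⟩,
    ⟨1 / 12, 6 + |Braess.tInfty + Real.eulerMascheroniConstant - 2|, by norm_num, by positivity,
      ⌈Real.exp 6⌉₊, fun a b ha hb => ?_⟩⟩
  · rw [Braess.numBraess_spider ha hb]
    push_cast
    have := mul_le_mul_of_nonneg_left (Braess.card_braessPairs_le ha hb)
      (by positivity : (0 : ℝ) ≤ b)
    linarith
  · have hexp : Real.exp 6 ≤ a := (Nat.le_ceil _).trans (by exact_mod_cast ha)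
    have hlog : 6 ≤ Real.log a := (Real.le_log_iff_exp_le ((Real.exp_pos 6).trans_le hexp)).2 hexp
    have ha2 : 2 ≤ a := by
      have h1 := Real.add_one_le_exp 6
      have h2 : (2 : ℝ) ≤ a := by linarith
      exact_mod_cast h2
    rw [Braess.numBraess_spider ha2 hb]
    push_cast
    have h1 : ((Braess.braessPairs a 2).card : ℝ) ≤ (Braess.braessPairs a b).card := by
      exact_mod_cast Finset.card_le_card (Braess.braessPairs_subset hb)
    have h2 := mul_le_mul_of_nonneg_left ((Braess.card_braessPairs_ge_log ha2 hlog).trans h1)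
      (by positivity : (0 : ℝ) ≤ b)
    have h3 := mul_le_mul_of_nonneg_left
      (Braess.card_braessPairs_le_log ha2 hb (by linarith : 1 ≤ Real.log a))
      (by positivity : (0 : ℝ) ≤ b)
    constructor <;> linarith
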